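/- **Conventions.** An infinite real matrix is *totally positive* (TP) if all its minors are nonnegative; a matrix over $\mathbb R[\mathbf x]$ is *$\mathbf x$-TP* if all its minors are polynomials in $\mathbf x$ with nonnegative coefficients. A series $\sum_{n\ge0}a_nt^n\in\mathbb R[[t]]$ is a *PF function* if its Toeplitz matrix $[a_{i-j}]_{i,j\ge0}$ (with $a_n=0$ for $n<0$) is TP. A real sequence $(a_n)_{n\ge0}$ is *Stieltjes moment* (SM) if $a_n=\int_0^\infty x^n\,d\mu(x)$ for all $n$, for some nonnegative measure $\mu$ on $[0,\infty)$; a sequence $(a_n)_{n\ge0}$ in $\mathbb R[\mathbf x]$ is *$\mathbf x$-SM* if its Hankel matrix $[a_{i+j}]_{i,j\ge0}$ is $\mathbf x$-TP. Put $\mathcal L[a_i]=a_{i-1}a_{i+1}-a_i^2$; the sequence is *$3$-$\mathbf x$-log-convex* (for real sequences: *$3$-log-convex*) if, for every $m\le 3$ and every index $i$ at which it is defined, $\mathcal L^m[a_i]$ has nonnegative coefficients (is nonnegative). Let $f(t)=\sum_{n\ge1}f_n\frac{t^n}{n!}\in\mathbb R[[t]]$ with $f_1\ne0$, and let $\bar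 f$ be its compositional inverse. For a power series $g$ with $g(0)\neq 0$, with coefficients in $\mathbb R$ or in a polynomial ring over $\mathbb R$, define $S_n(f,g;q)$ and $S_{n,k}(f,g)$ by $$g(t)\exp(qf(t))=\sum_{n\ge0}S_n(f,g;q)\frac{t^n}{n!},\qquad S_n(f,g;q)=\sum_{k=0}^nS_{n,k}(f,g)q^k,$$ with $S_{n,k}(f,g)=0$ for $k>n$, and let $S_n^*(f,g;q)=q^nS_n(f,g;1/q)$. Here $(1+f)^\gamma=\sum_{n\ge0}\binom{\gamma}{n}f^n$. **Theorem.** Suppose that $\dfrac{1}{(1+t)\bar f'(t)}$ is a PF function, and let $g(t)=(1+f(t))^{\gamma}\exp(\lambda f(t))$. In (i), (ii), (iv), $\gamma,\lambda,q$ are indeterminates; in (v), (vi), $\gamma,\lambda$ are real numbers. Then: - (i) both $(S_n(f,g;q))_{n\ge0}$ and $(S_n^*(f,g;q))_{n\ge0}$ are $(\gamma,\lambda,q)$-SM and $3$-$(\gamma,\lambda,q)$-log-convex; - (ii) $(S_n(f,(1+f)^\gamma;q))_{n\ge0}$ is $(\gamma,q)$-SM and $3$-$(\gamma,q)$-log-convex;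 - (iii) $(f_{n+1})_{n\ge0}$ is SM and $3$-log-convex; - (iv) the triangle $[S_{n,k}(f,g)]_{n,k\ge0}$ is $(\gamma,\lambda)$-TP; - (v) for $\gamma\ge0$ and $\lambda\ge0$, the triangle $\left[(-1)^{n-k}S_{n,k}\bigl(\bar f,1/g(\bar f)\bigr)\right]_{n,k\ge0}$ is TP; - (vi) for $\gamma\ge0$ and $\lambda\ge0$, the convolution $z_n=\sum_{k=0}^nS_{n,k}(f,g)\,x_k\,y_{n-k}$ preserves the SM property: if $(x_n)_{n\ge0}$ and $(y_n)_{n\ge0}$ are SM sequences of real numbers, then so is $(z_n)_{n\ge0}$. -/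

import Mathlib

/-! ### Total positivity, Stieltjes moments and iterated log-convexity -/

/-- The minor of an infinite matrix in the rows `r 0 < r 1 < ⋯` and columns `c 0 < c 1 < ⋯`. -/
def matMinor {R : Type*} [CommRing R] (M : Matrix ℕ ℕ R) {m : ℕ} (r c : Fin m ↪o ℕ) : R :=
  (M.submatrix r c).det

/-- A real infinite matrix is totally positive if all its minors are nonnegative. -/
def IsTP (M : Matrix ℕ ℕ ℝ) : Prop :=
  ∀ (m : ℕ) (r c : Fin m ↪o ℕ), 0 ≤ matMinor M r c

/-- A polynomial in the indeterminates `x_i`, `i : σ`, all of whose coefficients are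
nonnegative. -/
def CoeffNonneg {σ : Type*} (p : MvPolynomial σ ℝ) : Prop :=
  ∀ d : σ →₀ ℕ, 0 ≤ p.coeff d

/-- `𝐱`-total positivity of a matrix of polynomials in the indeterminates `𝐱 = (x_i)_{i : σ}`. -/
def IsCoeffTP {σ : Type*} (M : Matrix ℕ ℕ (MvPolynomial σ ℝ)) : Prop :=
  ∀ (m : ℕ) (r c : Fin m ↪o ℕ), CoeffNonneg (matMinor M r c)

/-- The infinite Hankel matrix `[a_{i+j}]`. -/
def hankelMatrix {R : Type*} (a : ℕ → R) : Matrix ℕ ℕ R :=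
  Matrix.of fun i j => a (i + j)

/-- The infinite Toeplitz matrix `[a_{i-j}]`, with `a_n = 0` for `n < 0`. -/
def toeplitzMatrix {R : Type*} [Zero R] (a : ℕ → R) : Matrix ℕ ℕ R :=
  Matrix.of fun i j => if j ≤ i then a (i - j) else 0

/-- A formal power series is a PF (Pólya frequency) function if the Toeplitz matrix of its
coefficient sequence is totally positive. -/
def IsPF (φ : PowerSeries ℝ) : Prop :=
  IsTP (toeplitzMatrix fun n => PowerSeries.coeff n φ)

/-- A real sequence is a Stieltjes moment sequence if it is the moment sequence of a nonnegative
measure on `[0, ∞)`. -/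
def IsStieltjesMoment (a : ℕ → ℝ) : Prop :=
  ∃ μ : MeasureTheory.Measure ℝ, μ (Set.Iio 0) = 0 ∧
    ∀ k : ℕ, MeasureTheory.Integrable (fun x : ℝ => x ^ k) μ ∧ a k = ∫ x, x ^ k ∂μ

/-- A polynomial sequence is `𝐱`-Stieltjes moment if its Hankel matrix is `𝐱`-totally
positive. -/
def IsCoeffSM {σ : Type*} (a : ℕ → MvPolynomial σ ℝ) : Prop :=
  IsCoeffTP (hankelMatrix a)

/-- The operator `ℒ[a_i] = a_{i-1} a_{i+1} - a_i ^ 2` (`i ≥ 1`), indexed from `0`: the value at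
`i` is `ℒ[a_{i+1}]`. Hence the value of its `m`-th iterate at `i` is `ℒ^m[a_{i+m}]`, which runs
through all the indices at which `ℒ^m` is defined. -/
def logConvexOp {R : Type*} [CommRing R] (a : ℕ → R) : ℕ → R :=
  fun i => a i * a (i + 2) - a (i + 1) ^ 2

/-- `k`-log-convexity of a real sequence. -/
def IsKLogConvex (k : ℕ) (a : ℕ → ℝ) : Prop :=
  ∀ m ≤ k, ∀ i : ℕ, 0 ≤ (logConvexOp^[m] a) i

/-- `k`-`𝐱`-log-convexity of a sequence of polynomials. -/
def IsKCoeffLogConvex {σ : Type*} (k : ℕ) (a : ℕ → MvPolynomial σ ℝ) : Prop :=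
  ∀ m ≤ k, ∀ i : ℕ, CoeffNonneg ((logConvexOp^[m] a) i)

/-! ### Sheffer polynomials and Sheffer triangles -/

section Sheffer

variable {R : Type*} [CommRing R]

/-- The formal power series `exp (c F(t))`, where `F(0) = 0`. -/
noncomputable def expSeries [Algebra ℚ R] (c : R) (F : PowerSeries R) : PowerSeries R :=
  (PowerSeries.exp R).subst (PowerSeries.C c * F)

/-- The formal power series `(1 + F(t)) ^ γ = ∑ₙ binom(γ, n) F(t) ^ n`, where `F(0) = 0`. -/
noncomputable def onePlusPow [BinomialRing R] (γ : R) (F : PowerSeries R) : PowerSeries R :=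
  (PowerSeries.binomialSeries R γ).subst F

/-- The formal power series `(1 + F(t)) ^ γ * exp (l F(t))`, where `F(0) = 0`. -/
noncomputable def shefferG [Algebra ℚ R] [BinomialRing R] (γ l : R) (F : PowerSeries R) :
    PowerSeries R :=
  onePlusPow γ F * expSeries l F

/-- The Sheffer polynomial `S_n(F, G; q)`, a polynomial in `q` over `R`, given by
`∑ₙ S_n(F, G; q) t ^ n / n! = G(t) exp (q F(t))`. -/
noncomputable def shefferPoly [Algebra ℚ R] (F G : PowerSeries R) (n : ℕ) : Polynomial R :=
  (n.factorial : Polynomial R) *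
    PowerSeries.coeff n
      (G.map Polynomial.C * expSeries (Polynomial.X : Polynomial R) (F.map Polynomial.C))

/-- The Sheffer triangle `S_{n,k}(F, G)`: the coefficient of `q ^ k` in `S_n(F, G; q)`. -/
noncomputable def shefferTriangle [Algebra ℚ R] (F G : PowerSeries R) : Matrix ℕ ℕ R :=
  Matrix.of fun n k => (shefferPoly F G n).coeff k

/-- The sequence `S_n(F, G; q)` at an element `q` of `R`. -/
noncomputable def shefferSeq [Algebra ℚ R] (F G : PowerSeries R) (q : R) : ℕ → R :=
  fun n => (shefferPoly F G n).eval q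

/-- The sequence of reciprocal polynomials `S*_n(F, G; q) = q ^ n S_n(F, G; 1/q)`, at an element
`q` of `R`. -/
noncomputable def shefferRecipSeq [Algebra ℚ R] (F G : PowerSeries R) (q : R) : ℕ → R :=
  fun n => ((shefferPoly F G n).reflect n).eval q

end Sheffer

/-- A real formal power series regarded as a series with coefficients in `ℝ[𝐱]`. -/
noncomputable def liftSeries (σ : Type*) (f : PowerSeries ℝ) : PowerSeries (MvPolynomial σ ℝ) :=
  f.map MvPolynomial.C

/-- The composition `G(F(t))` of real formal power series, where `F(0) = 0`. -/
noncomputable def composeSeries (G F : PowerSeries ℝ) : PowerSeries ℝ :=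
  G.subst F

/-- The triangular convolution `z_n = ∑_{k ≤ n} A_{n,k} x_k y_{n-k}`. -/
def triConvolution (A : Matrix ℕ ℕ ℝ) (x y : ℕ → ℝ) : ℕ → ℝ :=
  fun n => ∑ k ∈ Finset.range (n + 1), A n k * x k * y (n - k)

/-!
Put `φ = 1 / ((1 + t) f̄')`. Then `f' = (1 + f) φ(f)`, and `g = (1 + f) ^ γ exp (l f)` satisfies
`g' = (γ + l (1 + f)) φ(f) g`. Differentiating `g f ^ k / k!` therefore shows that each row of the
Sheffer triangle of `g` and `f` is the previous one times a fixed production matrix, the product of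
the Toeplitz matrix of `φ`, rescaled by factorials, and the matrix of the operator
`(1 + s) (∂ + l) + γ` in the basis `s ^ k / k!`. The latter is tridiagonal, a product of two
matrices whose minors are zero or products of entries, so the production matrix has coefficientwise
nonnegative minors. By the Cauchy–Binet formula this passes to the triangle it generates and to the
Hankel matrix of the zeroth column of that triangle.

The form `∑ₖ S_{n,k} u ^ k v ^ (n - k)` is itself the zeroth column of the triangle of a system of
the same kind, which gives the Hankel matrices of `S_n` and `S_n^*`; dividing `S_{n + 1}(f, 1; q)`
by `q` and letting `q → 0` gives those of `f_{n + 1}`. Log-convexity up to order three holds because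
the first three iterates of `ℒ` are subtraction-free polynomials in Hankel minors. The inverse of
the triangle is again a Sheffer triangle, and Jacobi's formula equates its minors, up to sign and a
positive factor, with minors of the triangle. Finally, the convolution of two moment sequences is
the integral of the moment sequences `∑ₖ S_{n,k} u ^ k v ^ (n - k)` against both representing
measures, and it is a moment sequence by Haviland's theorem: being one amounts to the nonnegativity
of the functional `X ^ n ↦ a n` on polynomials nonnegative on `[0, ∞)`, which integration preserves.
-/

section CauchyBinet

open Finset Matrix

variable {R : Type*} [CommRing R]

theorem det_mul_eq_sum_prod {m n : Type*} [Fintype m] [DecidableEq m] [Fintype n]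
    (A : Matrix m n R) (B : Matrix n m R) :
    (A * B).det = ∑ p : m → n, (A.submatrix id p).det * ∏ i, B (p i) i := by
  classical
  simp only [det_apply', mul_apply, prod_univ_sum, Fintype.piFinset_univ, mul_sum, sum_mul]
  rw [sum_comm]
  simp only [submatrix_apply, id, prod_mul_distrib, mul_assoc]

theorem orderEmbedding_comp_perm_injective {m : ℕ} {α : Type*} [LinearOrder α] :
    Function.Injective fun x : (Fin m ↪o α) × Equiv.Perm (Fin m) => (x.1 ∘ x.2 : Fin m → α) := by
  rintro ⟨s, σ⟩ ⟨s', σ'⟩ (h : s ∘ σ = s' ∘ σ')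
  have hrange : Set.range s = Set.range s' := by
    rw [← σ.surjective.range_comp s, ← σ'.surjective.range_comp s', h]
  obtain rfl : s = s' := DFunLike.coe_injective ((s.strictMono.range_inj s'.strictMono).1 hrange)
  rw [Equiv.ext fun i => s.injective (congrFun h i)]

theorem exists_orderEmbedding_comp_perm {m : ℕ} {α : Type*} [LinearOrder α] {p : Fin m → α}
    (hp : Function.Injective p) : ∃ (s : Fin m ↪o α) (σ : Equiv.Perm (Fin m)), s ∘ σ = p := by
  have hmono : StrictMono (p ∘ Tuple.sort p) :=
    (Tuple.monotone_sort p).strictMono_of_injective (hp.comp (Tuple.sort p).injective)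
  refine ⟨OrderEmbedding.ofStrictMono _ hmono, (Tuple.sort p)⁻¹, ?_⟩
  ext i
  simp

/-- The **Cauchy–Binet formula**. -/
theorem det_mul_eq_sum_orderEmbedding {m N : ℕ} (A : Matrix (Fin m) (Fin N) R)
    (B : Matrix (Fin N) (Fin m) R) :
    (A * B).det = ∑ s : Fin m ↪o Fin N, (A.submatrix id s).det * (B.submatrix s id).det := by
  have regroup : ∑ x : (Fin m ↪o Fin N) × Equiv.Perm (Fin m),
      (A.submatrix id (x.1 ∘ x.2)).det * ∏ i, B (x.1 (x.2 i)) i = (A * B).det := by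
    rw [det_mul_eq_sum_prod]
    refine sum_of_injOn (fun x => x.1 ∘ x.2) orderEmbedding_comp_perm_injective.injOn
      (by simp) (fun p _ hp => ?_) fun _ _ => rfl
    have : ¬ Function.Injective p := fun hinj => hp <| by
      obtain ⟨s, σ, h⟩ := exists_orderEmbedding_comp_perm hinj
      exact ⟨(s, σ), by simp, h⟩
    obtain ⟨i, j, hij, hne⟩ := Function.not_injective_iff.1 this
    rw [det_zero_of_column_eq hne fun k => by simp [hij], zero_mul]
  rw [← regroup, Fintype.sum_prod_type]
  refine sum_congr rfl fun s _ => ?_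
  rw [det_apply' (B.submatrix s id), mul_sum]
  refine sum_congr rfl fun σ _ => ?_
  have : A.submatrix id (s ∘ σ) = (A.submatrix id s).submatrix id σ := rfl
  rw [this, det_permute']
  simp only [submatrix_apply, id]
  ring

end CauchyBinet

section MinorsIn

open Finset Matrix

variable {R : Type*} [CommRing R]

/-- All the minors of an infinite matrix lie in a given subsemiring. For the nonnegative reals
this is total positivity, for the polynomials with nonnegative coefficients it is
coefficientwise total positivity. -/
def MinorsIn (S : Subsemiring R) (M : Matrix ℕ ℕ R) : Prop :=
  ∀ (m : ℕ) (r c : Fin m ↪o ℕ), matMinor M r c ∈ S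

/-- `M` is the product of the infinite matrices `A` and `B`, in the sense that the partial sums
of each of its entries are eventually constant. -/
def IsFiniteProd (M A B : Matrix ℕ ℕ R) : Prop :=
  ∀ i j, ∀ᶠ N in Filter.atTop, M i j = ∑ l ∈ range N, A i l * B l j

variable {S : Subsemiring R} {M A B : Matrix ℕ ℕ R}

theorem MinorsIn.transpose (h : MinorsIn S M) : MinorsIn S Mᵀ := fun m r c => by
  rw [matMinor, ← transpose_submatrix, det_transpose]
  exact h m c r

theorem MinorsIn.entry (h : MinorsIn S M) (i j : ℕ) : M i j ∈ S := by
  simpa [matMinor] using h 1 (OrderEmbedding.ofStrictMono (fun _ => i) (Subsingleton.strictMono _))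
    (OrderEmbedding.ofStrictMono (fun _ => j) (Subsingleton.strictMono _))

theorem MinorsIn.submatrix (h : MinorsIn S M) (f g : ℕ ↪o ℕ) : MinorsIn S (M.submatrix f g) :=
  fun m r c => h m (r.trans f) (c.trans g)

theorem MinorsIn.map {R' : Type*} [CommRing R'] {S' : Subsemiring R'} (h : MinorsIn S M)
    (φ : R →+* R') (hφ : ∀ x ∈ S, φ x ∈ S') : MinorsIn S' (M.map φ) := fun m r c => by
  rw [matMinor, submatrix_map, ← RingHom.mapMatrix_apply, ← RingHom.map_det]
  exact hφ _ (h m r c)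

theorem MinorsIn.row_column_scaling (h : MinorsIn S M) {x y : ℕ → R} (hx : ∀ i, x i ∈ S)
    (hy : ∀ j, y j ∈ S) : MinorsIn S (of fun i j => x i * M i j * y j) := fun m r c => by
  have : matMinor (of fun i j => x i * M i j * y j) r c =
      (∏ j, y (c j)) * ((∏ i, x (r i)) * matMinor M r c) := by
    rw [matMinor, matMinor, ← det_mul_column, ← det_mul_row]
    congr 1
    ext i j
    simp only [submatrix_apply, of_apply]
    ring
  rw [this]
  exact mul_mem (prod_mem fun j _ => hy _) (mul_mem (prod_mem fun i _ => hx _) (h m r c))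

theorem matMinor_pow_sub_mul (hM : ∀ i j, i < j → M i j = 0) (a : R) {m : ℕ} (r c : Fin m ↪o ℕ) :
    matMinor (of fun i j => a ^ (i - j) * M i j) r c =
      a ^ (∑ i, r i - ∑ i, c i) * matMinor M r c := by
  rw [matMinor, matMinor, det_apply', det_apply', mul_sum]
  refine sum_congr rfl fun σ _ => ?_
  simp only [submatrix_apply, of_apply, prod_mul_distrib]
  by_cases h : ∀ i, c i ≤ r (σ i)
  · rw [prod_pow_eq_pow_sum, sum_tsub_distrib _ fun i _ => h i, Equiv.sum_comp σ fun i => r i]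
    ring
  · obtain ⟨i, hi⟩ := not_forall.1 h
    have : ∏ i, M (r (σ i)) (c i) = 0 := prod_eq_zero (mem_univ i) (hM _ _ (not_le.1 hi))
    simp only [this, mul_zero]

theorem MinorsIn.pow_sub_mul (h : MinorsIn S M) (hM : ∀ i j, i < j → M i j = 0) {a : R}
    (ha : a ∈ S) : MinorsIn S (of fun i j => a ^ (i - j) * M i j) := fun m r c => by
  rw [matMinor_pow_sub_mul hM]
  exact mul_mem (pow_mem ha _) (h m r c)

theorem IsFiniteProd.matMinor_mem (h : IsFiniteProd M A B) {m : ℕ} (r c : Fin m ↪o ℕ)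
    (hA : ∀ s : Fin m ↪o ℕ, matMinor A r s ∈ S) (hB : MinorsIn S B) : matMinor M r c ∈ S := by
  obtain ⟨N, hN⟩ : ∃ N, ∀ i j, M (r i) (c j) = ∑ l ∈ range N, A (r i) l * B l (c j) :=
    (Filter.eventually_all.2 fun i => Filter.eventually_all.2 fun j => h (r i) (c j)).exists
  have hM : M.submatrix r c =
      A.submatrix r (Fin.val (n := N)) * B.submatrix (Fin.val (n := N)) c := by
    ext i j
    rw [submatrix_apply, hN, mul_apply, sum_range]
    rfl
  rw [matMinor, hM, det_mul_eq_sum_orderEmbedding]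
  exact sum_mem fun s _ => mul_mem (hA (s.trans (Fin.valOrderEmb N)))
    (hB m (s.trans (Fin.valOrderEmb N)) c)

theorem IsFiniteProd.minorsIn (h : IsFiniteProd M A B) (hA : MinorsIn S A) (hB : MinorsIn S B) :
    MinorsIn S M :=
  fun _ r c => h.matMinor_mem r c (hA _ r) hB

theorem matMinor_succ_of_row {m : ℕ} (r c : Fin (m + 1) ↪o ℕ)
    (h : ∀ j, j ≠ 0 → M (r 0) (c j) = 0) :
    matMinor M r c = M (r 0) (c 0) *
      matMinor M ((Fin.succOrderEmb m).trans r) ((Fin.succOrderEmb m).trans c) := by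
  rw [matMinor, det_succ_row_zero, sum_eq_single 0 (fun j _ hj => by simp [h j hj]) (by simp)]
  simp only [Fin.val_zero, pow_zero, one_mul, submatrix_apply]
  rfl

theorem matMinor_succ_of_column {m : ℕ} (r c : Fin (m + 1) ↪o ℕ)
    (h : ∀ i, i ≠ 0 → M (r i) (c 0) = 0) :
    matMinor M r c = M (r 0) (c 0) *
      matMinor M ((Fin.succOrderEmb m).trans r) ((Fin.succOrderEmb m).trans c) := by
  have transpose : ∀ {k : ℕ} (r c : Fin k ↪o ℕ), matMinor M r c = matMinor Mᵀ c r := fun r c => by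
    rw [matMinor, matMinor, ← det_transpose, transpose_submatrix]
  rw [transpose, transpose, matMinor_succ_of_row c r h, transpose_apply]

/-- Expanding a minor along its first row or its first column leaves a single product. -/
theorem minorsIn_of_forall_right_or_below (hS : ∀ i j, M i j ∈ S)
    (h : ∀ i j, (∀ j' > j, M i j' = 0) ∨ (∀ i' > i, M i' j = 0)) : MinorsIn S M := by
  intro m
  induction m with
  | zero => simp [matMinor]
  | succ m ih =>
    intro r c
    rcases h (r 0) (c 0) with h | h
    · rw [matMinor_succ_of_row r c fun j hj => h _ (c.strictMono (Fin.pos_iff_ne_zero.2 hj))]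
      exact mul_mem (hS _ _) (ih _ _)
    · rw [matMinor_succ_of_column r c fun i hi => h _ (r.strictMono (Fin.pos_iff_ne_zero.2 hi))]
      exact mul_mem (hS _ _) (ih _ _)

end MinorsIn

section Nonnegativity

theorem isTP_iff_minorsIn {M : Matrix ℕ ℕ ℝ} : IsTP M ↔ MinorsIn (Subsemiring.nonneg ℝ) M :=
  Iff.rfl

variable {σ : Type*}

/-- The subsemiring of polynomials with nonnegative coefficients. -/
def coeffNonnegSubsemiring (σ : Type*) : Subsemiring (MvPolynomial σ ℝ) where
  carrier := {p | CoeffNonneg p}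
  mul_mem' {p q} hp hq d := by
    classical
    rw [MvPolynomial.coeff_mul]
    exact Finset.sum_nonneg fun x _ => mul_nonneg (hp _) (hq _)
  one_mem' d := by
    classical
    rw [MvPolynomial.coeff_one]
    split_ifs <;> simp
  add_mem' {p q} hp hq d := by
    rw [MvPolynomial.coeff_add]
    exact add_nonneg (hp _) (hq _)
  zero_mem' _ := by simp

theorem isCoeffTP_iff_minorsIn {M : Matrix ℕ ℕ (MvPolynomial σ ℝ)} :
    IsCoeffTP M ↔ MinorsIn (coeffNonnegSubsemiring σ) M :=
  Iff.rfl

theorem C_mem_coeffNonnegSubsemiring {x : ℝ} (hx : 0 ≤ x) :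
    MvPolynomial.C x ∈ coeffNonnegSubsemiring σ := fun d => by
  classical
  rw [MvPolynomial.coeff_C]
  split_ifs
  exacts [hx, le_rfl]

theorem X_mem_coeffNonnegSubsemiring (i : σ) : MvPolynomial.X i ∈ coeffNonnegSubsemiring σ :=
  fun d => by
    classical
    rw [MvPolynomial.coeff_X]
    split_ifs <;> simp

end Nonnegativity

section OutputMatrix

open Finset Matrix

variable {R : Type*} [CommRing R] {S : Subsemiring R} {T P : Matrix ℕ ℕ R}

/-- `T` is the output matrix of the production matrix `P`: its row `0` is `e₀`, and its row
`n + 1` is its row `n` multiplied by `P`. -/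
structure IsOutputMatrix (T P : Matrix ℕ ℕ R) : Prop where
  zero : ∀ k, T 0 k = if k = 0 then 1 else 0
  succ : IsFiniteProd (of fun n k => T (n + 1) k) T P

theorem exists_orderEmbedding_add_one {m : ℕ} (r : Fin m ↪o ℕ) (hr : ∀ i, 0 < r i) :
    ∃ r' : Fin m ↪o ℕ, ∀ i, r i = r' i + 1 :=
  ⟨OrderEmbedding.ofStrictMono (fun i => r i - 1) fun i _ hij =>
    Nat.sub_lt_sub_right (hr i) (r.strictMono hij), fun i => (Nat.sub_add_cancel (hr i)).symm⟩

theorem IsOutputMatrix.matMinor_mem_of_rows_succ (h : IsOutputMatrix T P) (hP : MinorsIn S P)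
    {m : ℕ} {r r' : Fin m ↪o ℕ} (hr : ∀ i, r i = r' i + 1) (c : Fin m ↪o ℕ)
    (hT : ∀ s : Fin m ↪o ℕ, matMinor T r' s ∈ S) : matMinor T r c ∈ S := by
  have : matMinor T r c = matMinor (of fun n k => T (n + 1) k) r' c := by
    rw [matMinor, matMinor]
    congr 1
    ext i j
    simp [hr]
  rw [this]
  exact h.succ.matMinor_mem r' c hT hP

theorem IsOutputMatrix.minorsIn (h : IsOutputMatrix T P) (hP : MinorsIn S P) : MinorsIn S T := by
  suffices ∀ (n m : ℕ) (r c : Fin m ↪o ℕ), (∀ i, r i < n) → matMinor T r c ∈ S by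
    intro m r c
    obtain ⟨n, hn⟩ := (univ.image r).exists_nat_subset_range
    exact this n m r c fun i => mem_range.1 (hn (mem_image_of_mem r (mem_univ i)))
  intro n
  induction n with
  | zero =>
    rintro (_ | m) r c hr
    · simp [matMinor]
    · exact absurd (hr 0) (Nat.not_lt_zero _)
  | succ n ih =>
    have pos : ∀ (m : ℕ) (r c : Fin m ↪o ℕ), (∀ i, r i < n + 1) → (∀ i, 0 < r i) →
        matMinor T r c ∈ S := by
      intro m r c hr hr0
      obtain ⟨r', hr'⟩ := exists_orderEmbedding_add_one r hr0
      exact h.matMinor_mem_of_rows_succ hP hr' c fun s => ih m r' s fun i => by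
        linarith [hr i, hr' i]
    rintro (_ | m) r c hr
    · simp [matMinor]
    by_cases hr0 : r 0 = 0
    · have hrow : ∀ j, j ≠ 0 → T (r 0) (c j) = 0 := fun j hj => by
        have := c.strictMono (Fin.pos_iff_ne_zero.2 hj)
        rw [hr0, h.zero, if_neg (by omega)]
      rw [matMinor_succ_of_row r c hrow, hr0, h.zero]
      refine mul_mem ?_ (pos m _ _ (fun i => hr _) fun i => ?_)
      · split_ifs
        exacts [S.one_mem, S.zero_mem]
      · exact (Nat.zero_le _).trans_lt (r.strictMono (Fin.succ_pos i))
    · exact pos _ r c hr fun i => (Nat.pos_of_ne_zero hr0).trans_le (r.monotone (Fin.zero_le i))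

theorem sum_range_eq_of_le {α : Type*} [AddCommMonoid α] {f : ℕ → α} {a N : ℕ} (hN : a ≤ N)
    (hf : ∀ l, a ≤ l → f l = 0) : ∑ l ∈ range N, f l = ∑ l ∈ range a, f l := by
  refine (sum_subset (range_subset_range.2 hN) fun l _ hl => hf l ?_).symm
  simpa using hl

theorem IsOutputMatrix.eq_zero_of_lt (h : IsOutputMatrix T P)
    (hP : ∀ k l, k + 1 < l → P k l = 0) : ∀ n k, n < k → T n k = 0 := by
  intro n
  induction n with
  | zero =>
    intro k hk
    rw [h.zero, if_neg hk.ne']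
  | succ n ih =>
    intro k hk
    obtain ⟨N, hN⟩ := (h.succ n k).exists
    rw [of_apply] at hN
    rw [hN]
    refine sum_eq_zero fun j _ => ?_
    rcases Nat.lt_or_ge n j with hj | hj
    · rw [ih j hj, zero_mul]
    · rw [hP j k (by omega), mul_zero]

theorem IsOutputMatrix.succ_eq_sum (h : IsOutputMatrix T P)
    (hP : ∀ k l, k + 1 < l → P k l = 0) (n k : ℕ) :
    T (n + 1) k = ∑ j ∈ range (n + 1), T n j * P j k := by
  obtain ⟨N, hN, hle⟩ := ((h.succ n k).and (Filter.eventually_ge_atTop (n + 1))).exists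
  rw [of_apply] at hN
  rw [hN, sum_range_eq_of_le hle fun l hl => by rw [h.eq_zero_of_lt hP n l hl, zero_mul]]

/-- The first columns of the powers of `P`, where `P k l = 0` for `l > k + 1`: row `j` is the
column `P ^ j e₀`. -/
def columnPowers (P : Matrix ℕ ℕ R) : Matrix ℕ ℕ R
  | 0 => fun k => if k = 0 then 1 else 0
  | j + 1 => fun k => ∑ l ∈ range (k + 2), P k l * columnPowers P j l

theorem isOutputMatrix_columnPowers (hP : ∀ k l, k + 1 < l → P k l = 0) :
    IsOutputMatrix (columnPowers P) Pᵀ where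
  zero _ := rfl
  succ n k := by
    filter_upwards [Filter.eventually_ge_atTop (k + 2)] with N hN
    rw [sum_range_eq_of_le hN fun l hl => by rw [transpose_apply, hP k l hl, mul_zero]]
    simp only [of_apply, columnPowers, transpose_apply, mul_comm]

theorem IsOutputMatrix.apply_add_zero (h : IsOutputMatrix T P)
    (hP : ∀ k l, k + 1 < l → P k l = 0) (i j : ℕ) :
    T (i + j) 0 = ∑ k ∈ range (i + 1), T i k * columnPowers P j k := by
  induction j generalizing i with
  | zero => simp [columnPowers]
  | succ j ih =>
    rw [← add_assoc, add_right_comm, ih]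
    simp_rw [h.succ_eq_sum hP i, sum_mul, columnPowers, mul_sum, mul_assoc]
    rw [sum_comm]
    refine sum_congr rfl fun k hk => sum_range_eq_of_le ?_ fun l hl => ?_
    · have := mem_range.1 hk
      omega
    · rw [hP k l hl, zero_mul, mul_zero]

theorem IsOutputMatrix.minorsIn_hankel (h : IsOutputMatrix T P)
    (hP : ∀ k l, k + 1 < l → P k l = 0) (hPS : MinorsIn S P) :
    MinorsIn S (hankelMatrix fun n => T n 0) := by
  have hprod : IsFiniteProd (hankelMatrix fun n => T n 0) T (columnPowers P)ᵀ := fun i j => by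
    filter_upwards [Filter.eventually_ge_atTop (i + 1)] with N hN
    rw [sum_range_eq_of_le hN fun l hl => by rw [h.eq_zero_of_lt hP i l hl, zero_mul]]
    exact h.apply_add_zero hP i j
  exact hprod.minorsIn (h.minorsIn hPS)
    ((isOutputMatrix_columnPowers hP).minorsIn hPS.transpose).transpose

end OutputMatrix

section ProductionMatrix

open Finset Matrix

variable {R : Type*} [CommRing R] {S : Subsemiring R}

/-- The matrix whose column `k` is supported in the rows `2 k - 1`, `2 k`, `2 k + 1`, with the
entries `w k`, `p k`, `q k` there (`w 0` is not used). The supports of two columns overlap in at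
most one row, at an end of each. -/
def staircaseMatrix (w p q : ℕ → R) : Matrix ℕ ℕ R :=
  of fun t k => if t + 1 = 2 * k then w k else if t = 2 * k then p k
    else if t = 2 * k + 1 then q k else 0

theorem minorsIn_staircaseMatrix {w p q : ℕ → R} (hw : ∀ k, w k ∈ S) (hp : ∀ k, p k ∈ S)
    (hq : ∀ k, q k ∈ S) : MinorsIn S (staircaseMatrix w p q) := by
  refine minorsIn_of_forall_right_or_below (fun i j => ?_) fun i j => ?_ <;>
    simp only [staircaseMatrix, of_apply]
  · split_ifs
    exacts [hw j, hp j, hq j, S.zero_mem]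
  · rcases Nat.lt_or_ge (2 * j) i with h | h
    · exact .inr fun i' hi' => by
        rw [if_neg (by omega), if_neg (by omega), if_neg (by omega)]
    · exact .inl fun j' hj' => by
        rw [if_neg (by omega), if_neg (by omega), if_neg (by omega)]

theorem sum_staircaseMatrix_mul (w p q : ℕ → R) (hw : w 0 = 0) (x : ℕ → R) {k N : ℕ}
    (hN : 2 * k + 2 ≤ N) :
    ∑ t ∈ range N, staircaseMatrix w p q t k * x t =
      w k * x (2 * k - 1) + p k * x (2 * k) + q k * x (2 * k + 1) := by
  have vanish : ∀ t, t + 1 < 2 * k ∨ 2 * k + 2 ≤ t → staircaseMatrix w p q t k * x t = 0 := by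
    intro t ht
    rw [staircaseMatrix, of_apply, if_neg (by omega), if_neg (by omega), if_neg (by omega),
      zero_mul]
  rw [sum_range_eq_of_le hN fun t ht => vanish t (.inr ht), sum_range_succ, sum_range_succ]
  congr 2
  · cases k with
    | zero => simp [hw]
    | succ k =>
      rw [show 2 * (k + 1) = 2 * k + 1 + 1 by ring, sum_range_succ,
        sum_eq_zero fun t ht => vanish t (.inl (by have := mem_range.1 ht; omega))]
      simp [staircaseMatrix, mul_add]
  · simp [staircaseMatrix]
  · simp [staircaseMatrix, show 2 * k + 1 + 1 ≠ 2 * k by omega]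

/-- The matrix of the operator `(1 + a s) (∂ + b) + c` in the basis `s ^ k / k!`. -/
def shefferTridiagonal (a b c : R) : Matrix ℕ ℕ R :=
  of fun l k => if l = k then a * l + b + c else if l + 1 = k then 1
    else if l = k + 1 then a * b * l else 0

theorem isFiniteProd_shefferTridiagonal (a b c : R) :
    IsFiniteProd (shefferTridiagonal a b c) (staircaseMatrix (fun k => a * k) (fun _ => c) 1)ᵀ
      (staircaseMatrix 1 1 fun _ => b) := fun l k => by
  filter_upwards [Filter.eventually_ge_atTop (2 * l + 2)] with N hN
  simp only [transpose_apply]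
  rw [sum_staircaseMatrix_mul _ _ _ (by simp) _ hN]
  simp only [shefferTridiagonal, staircaseMatrix, of_apply, Pi.one_apply]
  cases l <;> grind

theorem minorsIn_shefferTridiagonal {a b c : R} (ha : a ∈ S) (hb : b ∈ S) (hc : c ∈ S) :
    MinorsIn S (shefferTridiagonal a b c) :=
  (isFiniteProd_shefferTridiagonal a b c).minorsIn
    (minorsIn_staircaseMatrix (fun k => mul_mem ha (natCast_mem S k)) (fun _ => hc)
      fun _ => S.one_mem).transpose
    (minorsIn_staircaseMatrix (fun _ => S.one_mem) (fun _ => S.one_mem) fun _ => hb)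

end ProductionMatrix

section ExponentialRiordan

open Finset Matrix PowerSeries

variable {R : Type*} [CommRing R]

/-- The coefficient of `t ^ n / n!` in a formal power series. -/
noncomputable def expCoeff (n : ℕ) : PowerSeries R →ₗ[R] R :=
  (n.factorial : R) • coeff n

theorem expCoeff_apply (n : ℕ) (ψ : PowerSeries R) :
    expCoeff n ψ = n.factorial * coeff n ψ :=
  rfl

theorem expCoeff_C_mul (n : ℕ) (x : R) (ψ : PowerSeries R) :
    expCoeff n (C x * ψ) = x * expCoeff n ψ := by
  rw [expCoeff_apply, expCoeff_apply, coeff_C_mul, mul_left_comm]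

theorem expCoeff_derivative (n : ℕ) (ψ : PowerSeries R) :
    expCoeff n (derivative R ψ) = expCoeff (n + 1) ψ := by
  rw [expCoeff_apply, expCoeff_apply, coeff_derivative, Nat.factorial_succ]
  push_cast
  ring

theorem expCoeff_zero_X_mul (ψ : PowerSeries R) : expCoeff 0 (X * ψ) = 0 := by
  simp [expCoeff_apply]

theorem expCoeff_succ_X_mul (n : ℕ) (ψ : PowerSeries R) :
    expCoeff (n + 1) (X * ψ) = (n + 1) * expCoeff n ψ := by
  rw [expCoeff_apply, expCoeff_apply, coeff_succ_X_mul, Nat.factorial_succ]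
  push_cast
  ring

theorem coeff_mul_pow_eq_zero {F : PowerSeries R} (hF : constantCoeff F = 0) (K : PowerSeries R)
    {n k : ℕ} (h : n < k) : coeff n (K * F ^ k) = 0 :=
  X_pow_dvd_iff.1 (dvd_mul_of_dvd_right (pow_dvd_pow_of_dvd (X_dvd_iff.2 hF) k) K) n h

theorem coeff_mul_subst {F : PowerSeries R} (hF : constantCoeff F = 0) (K ψ : PowerSeries R)
    (n : ℕ) : coeff n (K * ψ.subst F) = ∑ j ∈ range (n + 1), coeff j ψ * coeff n (K * F ^ j) := by
  have trunc : ∀ m ≤ n, coeff m (ψ.subst F) = ∑ j ∈ range (n + 1), coeff j ψ * coeff m (F ^ j) := by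
    intro m hm
    rw [coeff_subst' (HasSubst.of_constantCoeff_zero' hF)]
    refine finsum_eq_sum_of_support_subset _ fun j hj => ?_
    by_contra hjn
    refine hj ?_
    have := coeff_mul_pow_eq_zero hF 1 (n := m) (k := j) (by simp at hjn; omega)
    rw [one_mul] at this
    exact (congrArg (coeff j ψ • ·) this).trans (smul_zero _)
  have split : ∀ p ∈ antidiagonal n, coeff p.1 K * coeff p.2 (ψ.subst F) =
      ∑ j ∈ range (n + 1), coeff j ψ * (coeff p.1 K * coeff p.2 (F ^ j)) := fun p hp => by
    rw [trunc p.2 (by have := mem_antidiagonal.1 hp; omega), mul_sum]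
    exact sum_congr rfl fun j _ => mul_left_comm _ _ _
  rw [PowerSeries.coeff_mul, sum_congr rfl split, sum_comm]
  simp_rw [PowerSeries.coeff_mul, mul_sum]

variable [Algebra ℚ R]

/-- The divided power `F ^ k / k!`. -/
noncomputable def dividedPow (k : ℕ) (F : PowerSeries R) : PowerSeries R :=
  C (algebraMap ℚ R (1 / k.factorial)) * F ^ k

theorem algebraMap_one_div_mul_natCast {m : ℕ} (hm : m ≠ 0) :
    algebraMap ℚ R (1 / m) * (m : R) = 1 := by
  rw [← map_natCast (algebraMap ℚ R), ← map_mul, one_div_mul_cancel (Nat.cast_ne_zero.2 hm),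
    map_one]

theorem algebraMap_one_div_factorial_succ (k : ℕ) :
    algebraMap ℚ R (1 / (k + 1).factorial) * (k + 1) = algebraMap ℚ R (1 / k.factorial) := by
  have h : (1 / (k + 1).factorial : ℚ) * (k + 1) = 1 / k.factorial := by
    rw [Nat.factorial_succ]
    push_cast
    field_simp
  rw [← h, map_mul]
  simp

theorem dividedPow_zero (F : PowerSeries R) : dividedPow 0 F = 1 := by
  simp [dividedPow]

theorem X_mul_dividedPow_X (k : ℕ) :
    (X : PowerSeries R) * dividedPow k X = C ((k : R) + 1) * dividedPow (k + 1) X := by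
  rw [dividedPow, dividedPow, ← algebraMap_one_div_factorial_succ, map_mul]
  ring

theorem subst_dividedPow {F : PowerSeries R} (hF : constantCoeff F = 0) (k : ℕ)
    (ψ : PowerSeries R) : (dividedPow k ψ).subst F = dividedPow k (ψ.subst F) := by
  have hs : HasSubst F := HasSubst.of_constantCoeff_zero' hF
  rw [dividedPow, dividedPow, subst_mul hs, subst_pow hs, subst_C]
  rfl

theorem expCoeff_dividedPow_X (n k : ℕ) :
    expCoeff n (dividedPow k (X : PowerSeries R)) = if n = k then 1 else 0 := by
  rw [dividedPow, expCoeff_C_mul, expCoeff_apply, coeff_X_pow]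
  split_ifs with h
  · rw [h, mul_one, algebraMap_one_div_mul_natCast k.factorial_ne_zero]
  · rw [mul_zero, mul_zero]

/-- The exponential Riordan array of `H` and `F`: the entry `n, k` is the coefficient of
`t ^ n / n!` in `H F ^ k / k!`. -/
noncomputable def expRiordan (H F : PowerSeries R) : Matrix ℕ ℕ R :=
  of fun n k => expCoeff n (H * dividedPow k F)

theorem expRiordan_eq (H F : PowerSeries R) (n k : ℕ) : expRiordan H F n k =
    n.factorial * coeff n (H * F ^ k) * algebraMap ℚ R (1 / k.factorial) := by
  rw [expRiordan, of_apply, dividedPow, mul_left_comm, expCoeff_C_mul, expCoeff_apply]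
  ring

theorem expRiordan_eq_zero {F : PowerSeries R} (hF : constantCoeff F = 0) (H : PowerSeries R)
    {n k : ℕ} (h : n < k) : expRiordan H F n k = 0 := by
  rw [expRiordan_eq, coeff_mul_pow_eq_zero hF H h, mul_zero, zero_mul]

theorem expRiordan_apply_zero (H F : PowerSeries R) (n : ℕ) :
    expRiordan H F n 0 = expCoeff n H := by
  rw [expRiordan, of_apply, dividedPow_zero, mul_one]

theorem expRiordan_one_X : expRiordan (1 : PowerSeries R) X = 1 := by
  ext n k
  rw [expRiordan, of_apply, one_mul, expCoeff_dividedPow_X, one_apply]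

theorem expCoeff_mul_subst {F : PowerSeries R} (hF : constantCoeff F = 0) (H ψ : PowerSeries R)
    (n : ℕ) : expCoeff n (H * ψ.subst F) =
      ∑ j ∈ range (n + 1), expRiordan H F n j * expCoeff j ψ := by
  rw [expCoeff_apply, coeff_mul_subst hF, mul_sum]
  refine sum_congr rfl fun j _ => ?_
  rw [expRiordan_eq, expCoeff_apply]
  linear_combination (-n.factorial * coeff j ψ * coeff n (H * F ^ j)) *
    algebraMap_one_div_mul_natCast (R := R) j.factorial_ne_zero

theorem expRiordan_mul_apply {F : PowerSeries R} (hF : constantCoeff F = 0)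
    (G H K : PowerSeries R) (n k : ℕ) : expRiordan (H * K.subst F) (G.subst F) n k =
      ∑ j ∈ range (n + 1), expRiordan H F n j * expRiordan K G j k := by
  have hs : HasSubst F := HasSubst.of_constantCoeff_zero' hF
  calc expRiordan (H * K.subst F) (G.subst F) n k
      = expCoeff n (H * (K * dividedPow k G).subst F) := by
        rw [expRiordan, of_apply, subst_mul hs, subst_dividedPow hF, mul_assoc]
    _ = _ := expCoeff_mul_subst hF H _ n

end ExponentialRiordan

section PowerSeriesODE

open Finset PowerSeries

variable {R R' : Type*} [CommRing R] [CommRing R']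

theorem constantCoeff_map (ψ : R →+* R') (F : PowerSeries R) :
    constantCoeff (F.map ψ) = ψ (constantCoeff F) := by
  rw [← coeff_zero_eq_constantCoeff_apply, coeff_map, coeff_zero_eq_constantCoeff_apply]

theorem derivative_map (ψ : R →+* R') (F : PowerSeries R) :
    derivative R' (F.map ψ) = (derivative R F).map ψ := by
  ext n
  simp only [coeff_derivative, coeff_map, map_mul, map_add, map_natCast, map_one]

theorem map_subst_powerSeries {F : PowerSeries R} (hF : constantCoeff F = 0) (ψ : R →+* R')
    (φ : PowerSeries R) : PowerSeries.map ψ (φ.subst F) = (φ.map ψ).subst (F.map ψ) :=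
  map_subst (HasSubst.of_constantCoeff_zero' hF) φ

theorem subst_one_powerSeries {F : PowerSeries R} (hF : constantCoeff F = 0) :
    (1 : PowerSeries R).subst F = (1 : PowerSeries R) := by
  rw [← coe_substAlgHom (HasSubst.of_constantCoeff_zero' hF), map_one]

theorem constantCoeff_subst_powerSeries {F : PowerSeries R} (hF : constantCoeff F = 0)
    (ψ : PowerSeries R) : constantCoeff (ψ.subst F : PowerSeries R) = constantCoeff ψ := by
  simpa using coeff_mul_subst hF 1 ψ 0

theorem rescale_C (v x : R) : rescale v (C x) = C x := by
  ext n
  rw [coeff_rescale, coeff_C]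
  split_ifs with hn
  · rw [hn, pow_zero, one_mul]
  · rw [mul_zero]

theorem derivative_rescale (v : R) (F : PowerSeries R) :
    derivative R (rescale v F) = C v * rescale v (derivative R F) := by
  ext n
  rw [coeff_derivative, coeff_C_mul, coeff_rescale, coeff_rescale, coeff_derivative]
  ring

/-- The power series `F(v t) / v`, where `F(0) = 0`; it makes sense for every `v`, also for
`v = 0`. -/
noncomputable def rescaleDiv (v : R) (F : PowerSeries R) : PowerSeries R :=
  PowerSeries.mk fun n => v ^ (n - 1) * coeff n F

theorem rescale_eq_C_mul_rescaleDiv {F : PowerSeries R} (hF : constantCoeff F = 0) (v : R) :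
    rescale v F = C v * rescaleDiv v F := by
  ext n
  rw [coeff_rescale, coeff_C_mul, rescaleDiv, coeff_mk]
  rcases n with _ | n
  · simp only [coeff_zero_eq_constantCoeff_apply, hF, mul_zero]
  · rw [Nat.add_sub_cancel, pow_succ', mul_assoc]

theorem derivative_rescaleDiv (v : R) (F : PowerSeries R) :
    derivative R (rescaleDiv v F) = rescale v (derivative R F) := by
  ext n
  rw [coeff_derivative, rescaleDiv, coeff_mk, coeff_rescale, coeff_derivative, Nat.add_sub_cancel,
    mul_assoc]

theorem constantCoeff_rescaleDiv {F : PowerSeries R} (hF : constantCoeff F = 0) (v : R) :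
    constantCoeff (rescaleDiv v F) = 0 := by
  rw [← coeff_zero_eq_constantCoeff_apply, rescaleDiv, coeff_mk, coeff_zero_eq_constantCoeff_apply,
    hF, mul_zero]

theorem rescaleDiv_X_mul (v : R) (E : PowerSeries R) :
    rescaleDiv v (X * E) = X * rescale v E := by
  ext n
  rw [rescaleDiv, coeff_mk]
  rcases n with _ | n
  · rw [coeff_zero_X_mul, coeff_zero_X_mul, mul_zero]
  · rw [coeff_succ_X_mul, coeff_succ_X_mul, coeff_rescale, Nat.add_sub_cancel]

theorem coeff_rescale_mul_rescaleDiv_pow {F : PowerSeries R} (hF : constantCoeff F = 0) (v : R)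
    (G : PowerSeries R) (n k : ℕ) :
    coeff n (rescale v G * rescaleDiv v F ^ k) = v ^ (n - k) * coeff n (G * F ^ k) := by
  obtain ⟨E, rfl⟩ := X_dvd_iff.2 hF
  rw [rescaleDiv_X_mul, mul_pow, mul_left_comm, mul_pow X E, mul_left_comm G, ← map_pow, ← map_mul,
    coeff_X_pow_mul', coeff_X_pow_mul']
  split_ifs
  · rw [coeff_rescale]
  · rw [mul_zero]

theorem rescale_subst {F : PowerSeries R} (hF : constantCoeff F = 0) (v : R) (ψ : PowerSeries R) :
    rescale v (ψ.subst F) = (rescale v ψ).subst (rescaleDiv v F) := by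
  ext n
  have hl := coeff_mul_subst hF 1 ψ n
  have hr := coeff_mul_subst (constantCoeff_rescaleDiv hF v) (rescale v 1) (rescale v ψ) n
  simp only [coeff_rescale_mul_rescaleDiv_pow hF] at hr
  simp only [map_one, one_mul] at hl hr
  rw [coeff_rescale, hl, hr, mul_sum]
  refine sum_congr rfl fun j hj => ?_
  rw [coeff_rescale, ← Nat.add_sub_of_le (mem_range_succ_iff.1 hj), pow_add,
    Nat.add_sub_cancel_left]
  ring

theorem one_add_X_mul_derivative_binomialSeries [BinomialRing R] (γ : R) :
    (1 + X) * derivative R (binomialSeries R γ) = C γ * binomialSeries R γ := by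
  have choose_succ (n : ℕ) :
      ((n : R) + 1) * Ring.choose γ (n + 1) = (γ - n) * Ring.choose γ n := by
    have h := Ring.choose_smul_choose γ (Nat.le_succ n)
    simp only [Nat.succ_eq_add_one, Nat.choose_succ_self_right, nsmul_eq_mul,
      Nat.add_sub_cancel_left, Ring.choose_one_right] at h
    push_cast at h
    rw [h, mul_comm]
  ext n
  rw [add_mul, one_mul, map_add, coeff_C_mul, coeff_derivative, binomialSeries_coeff,
    binomialSeries_coeff, smul_eq_mul, smul_eq_mul, mul_one, mul_one]
  rcases n with _ | n
  · rw [coeff_zero_X_mul]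
    linear_combination choose_succ 0
  · rw [coeff_succ_X_mul, coeff_derivative, binomialSeries_coeff, smul_eq_mul, mul_one]
    have h := choose_succ (n + 1)
    push_cast at h ⊢
    linear_combination h

theorem constantCoeff_onePlusPow [BinomialRing R] {F : PowerSeries R} (hF : constantCoeff F = 0)
    (γ : R) : constantCoeff (onePlusPow γ F) = 1 := by
  rw [onePlusPow, constantCoeff_subst_powerSeries hF, binomialSeries_constantCoeff]

theorem one_add_mul_derivative_onePlusPow [BinomialRing R] {F : PowerSeries R}
    (hF : constantCoeff F = 0) (γ : R) :
    (1 + F) * derivative R (onePlusPow γ F) = C γ * derivative R F * onePlusPow γ F := by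
  have hs : HasSubst F := HasSubst.of_constantCoeff_zero' hF
  have h := congrArg (PowerSeries.subst F) (one_add_X_mul_derivative_binomialSeries γ)
  rw [subst_mul hs, subst_mul hs, subst_add hs, subst_X hs, subst_one_powerSeries hF,
    show (C γ).subst F = (C γ : PowerSeries R) from subst_C γ] at h
  rw [onePlusPow, derivative_subst hs]
  linear_combination derivative R F * h

variable [Algebra ℚ R]

theorem constantCoeff_expSeries {F : PowerSeries R} (hF : constantCoeff F = 0) (c : R) :
    constantCoeff (expSeries c F) = 1 := by
  rw [expSeries, constantCoeff_subst_powerSeries (by rw [map_mul, hF, mul_zero]),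
    constantCoeff_exp]

theorem derivative_expSeries {F : PowerSeries R} (hF : constantCoeff F = 0) (c : R) :
    derivative R (expSeries c F) = C c * derivative R F * expSeries c F := by
  have hs : HasSubst (C c * F) :=
    HasSubst.of_constantCoeff_zero' (by rw [map_mul, hF, mul_zero])
  rw [expSeries, derivative_subst hs, derivative_exp, Derivation.leibniz, derivative_C, smul_zero,
    add_zero, smul_eq_mul, mul_comm]

theorem expSeries_eq_subst {F : PowerSeries R} (hF : constantCoeff F = 0) (c : R) :
    expSeries c F = (rescale c (exp R)).subst F := by
  have hs : HasSubst F := HasSubst.of_constantCoeff_zero' hF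
  rw [expSeries, rescale_eq_subst, subst_comp_subst_apply (HasSubst.smul_X' c) hs, subst_smul hs,
    subst_X hs, smul_eq_C_mul]

theorem expSeries_zero {F : PowerSeries R} (hF : constantCoeff F = 0) :
    expSeries (0 : R) F = 1 := by
  rw [expSeries_eq_subst hF, rescale_zero_apply, constantCoeff_exp, map_one,
    subst_one_powerSeries hF]

end PowerSeriesODE

section ShefferSystem

open Finset Matrix PowerSeries

variable {R R' : Type*} [CommRing R] [CommRing R'] {a b c : R} {ω F H : PowerSeries R}

/-- The differential system satisfied by the two series of a Sheffer triangle with tridiagonal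
production: `F' = (1 + a F) ω(F)` and `H' = H (c + b (1 + a F)) ω(F)`, with `F(0) = 0` and
`H(0) = 1`. The parameter `a` is there to keep the class stable under rescaling. -/
structure IsShefferSystem (a b c : R) (ω F H : PowerSeries R) : Prop where
  constantCoeff_left : constantCoeff F = 0
  constantCoeff_right : constantCoeff H = 1
  derivative_left : derivative R F = (1 + C a * F) * ω.subst F
  derivative_right : derivative R H = H * (C c + C b * (1 + C a * F)) * ω.subst F

namespace IsShefferSystem

theorem map (h : IsShefferSystem a b c ω F H) (ψ : R →+* R') :
    IsShefferSystem (ψ a) (ψ b) (ψ c) (ω.map ψ) (F.map ψ) (H.map ψ) where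
  constantCoeff_left := by rw [constantCoeff_map, h.constantCoeff_left, map_zero]
  constantCoeff_right := by rw [constantCoeff_map, h.constantCoeff_right, map_one]
  derivative_left := by
    rw [derivative_map, h.derivative_left, map_mul, map_subst_powerSeries h.constantCoeff_left,
      map_add, map_one, map_mul, map_C]
  derivative_right := by
    rw [derivative_map, h.derivative_right, map_mul, map_subst_powerSeries h.constantCoeff_left]
    simp only [map_mul, map_add, map_one, map_C]

theorem rescale (h : IsShefferSystem a b c ω F H) (v : R) :
    IsShefferSystem (v * a) (v * b) (v * c) (rescale v ω) (rescaleDiv v F)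
      (PowerSeries.rescale v H) where
  constantCoeff_left := constantCoeff_rescaleDiv h.constantCoeff_left v
  constantCoeff_right := by
    rw [← coeff_zero_eq_constantCoeff_apply, coeff_rescale, pow_zero, one_mul,
      coeff_zero_eq_constantCoeff_apply, h.constantCoeff_right]
  derivative_left := by
    rw [derivative_rescaleDiv, h.derivative_left, map_mul, rescale_subst h.constantCoeff_left,
      map_add, map_one, map_mul, rescale_C, rescale_eq_C_mul_rescaleDiv h.constantCoeff_left,
      map_mul]
    ring
  derivative_right := by
    rw [derivative_rescale, h.derivative_right, map_mul, map_mul,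
      rescale_subst h.constantCoeff_left]
    simp only [map_add, map_one, map_mul, rescale_C,
      rescale_eq_C_mul_rescaleDiv h.constantCoeff_left]
    ring

theorem onePlusPow [BinomialRing R] (h : IsShefferSystem 1 b c ω F H) (γ : R) :
    IsShefferSystem 1 b (c + γ) ω F (H * onePlusPow γ F) where
  constantCoeff_left := h.constantCoeff_left
  constantCoeff_right := by
    rw [map_mul, h.constantCoeff_right, constantCoeff_onePlusPow h.constantCoeff_left, one_mul]
  derivative_left := h.derivative_left
  derivative_right := by
    have hunit : IsUnit (1 + F) := isUnit_iff_constantCoeff.2 <| by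
      rw [map_add, h.constantCoeff_left, map_one, add_zero]
      exact isUnit_one
    refine hunit.mul_left_cancel ?_
    have hpow := one_add_mul_derivative_onePlusPow h.constantCoeff_left γ
    rw [h.derivative_left] at hpow
    rw [Derivation.leibniz, h.derivative_right, smul_eq_mul, smul_eq_mul]
    simp only [map_add, map_one] at hpow ⊢
    linear_combination H * hpow

theorem expSeries [Algebra ℚ R] (h : IsShefferSystem a b c ω F H) (u : R) :
    IsShefferSystem a (b + u) c ω F (H * expSeries u F) where
  constantCoeff_left := h.constantCoeff_left
  constantCoeff_right := by
    rw [map_mul, h.constantCoeff_right, constantCoeff_expSeries h.constantCoeff_left, one_mul]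
  derivative_left := h.derivative_left
  derivative_right := by
    rw [Derivation.leibniz, h.derivative_right, derivative_expSeries h.constantCoeff_left,
      h.derivative_left, smul_eq_mul, smul_eq_mul, map_add]
    ring

end IsShefferSystem

/-- The operator `(1 + a X) (d/dX + b) + c` on power series. -/
noncomputable def tridiagonalOperator (a b c : R) (ψ : PowerSeries R) : PowerSeries R :=
  (1 + C a * X) * (derivative R ψ + C b * ψ) + C c * ψ

theorem IsShefferSystem.derivative_mul_subst (h : IsShefferSystem a b c ω F H)
    (ψ : PowerSeries R) :
    derivative R (H * ψ.subst F) = H * (ω * tridiagonalOperator a b c ψ).subst F := by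
  have hs : HasSubst F := HasSubst.of_constantCoeff_zero' h.constantCoeff_left
  have hC (x : R) : (C x).subst F = (C x : PowerSeries R) := subst_C x
  rw [Derivation.leibniz, derivative_subst hs, h.derivative_left, h.derivative_right,
    tridiagonalOperator]
  simp only [subst_mul hs, subst_add hs, subst_X hs, subst_one_powerSeries h.constantCoeff_left,
    hC, smul_eq_mul]
  ring

variable [Algebra ℚ R]

theorem expCoeff_tridiagonalOperator_dividedPow (a b c : R) (l k : ℕ) :
    expCoeff l (tridiagonalOperator a b c (dividedPow k X)) = shefferTridiagonal a b c l k := by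
  have h : tridiagonalOperator a b c (dividedPow k X) =
      derivative R (dividedPow k X) + C a * (X * derivative R (dividedPow k X)) +
        C (b + c) * dividedPow k X + C (a * b) * (X * dividedPow k X) := by
    rw [tridiagonalOperator, map_add, map_mul]
    ring
  rw [h, map_add, map_add, map_add, expCoeff_C_mul, expCoeff_C_mul, expCoeff_C_mul,
    expCoeff_derivative, X_mul_dividedPow_X, expCoeff_C_mul]
  cases l with
  | zero =>
    rw [expCoeff_zero_X_mul]
    simp only [expCoeff_dividedPow_X, shefferTridiagonal, of_apply]
    grind
  | succ l =>
    rw [expCoeff_succ_X_mul, expCoeff_derivative]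
    simp only [expCoeff_dividedPow_X, shefferTridiagonal, of_apply]
    grind

/-- The production matrix of a Sheffer system. -/
noncomputable def shefferProduction (a b c : R) (ω : PowerSeries R) : Matrix ℕ ℕ R :=
  of fun j k => expCoeff j (ω * tridiagonalOperator a b c (dividedPow k X))

theorem IsShefferSystem.isOutputMatrix (h : IsShefferSystem a b c ω F H) :
    IsOutputMatrix (expRiordan H F) (shefferProduction a b c ω) where
  zero k := by
    rw [expRiordan, of_apply, expCoeff_apply, coeff_zero_eq_constantCoeff_apply, map_mul,
      dividedPow, map_mul, map_pow, h.constantCoeff_left, h.constantCoeff_right, constantCoeff_C]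
    cases k <;> simp
  succ n k := by
    filter_upwards [Filter.eventually_ge_atTop (n + 1)] with N hN
    have hs : HasSubst F := HasSubst.of_constantCoeff_zero' h.constantCoeff_left
    calc expRiordan H F (n + 1) k
        = expCoeff n (derivative R (H * (dividedPow k X).subst F)) := by
          rw [expCoeff_derivative, subst_dividedPow h.constantCoeff_left, subst_X hs]
          rfl
      _ = ∑ j ∈ range (n + 1), expRiordan H F n j * shefferProduction a b c ω j k := by
          rw [h.derivative_mul_subst, expCoeff_mul_subst h.constantCoeff_left]
          rfl
      _ = _ := (sum_range_eq_of_le hN fun j hj => by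
          rw [expRiordan_eq_zero h.constantCoeff_left H hj, zero_mul]).symm

theorem isFiniteProd_shefferProduction (a b c : R) (ω : PowerSeries R) :
    IsFiniteProd (shefferProduction a b c ω) (expRiordan ω X) (shefferTridiagonal a b c) :=
  fun j k => by
  filter_upwards [Filter.eventually_ge_atTop (j + 1)] with N hN
  calc shefferProduction a b c ω j k
      = expCoeff j (ω * (tridiagonalOperator a b c (dividedPow k X)).subst X) := by
        rw [← map_algebraMap_eq_subst_X]
        rfl
    _ = ∑ l ∈ range (j + 1), expRiordan ω X j l * shefferTridiagonal a b c l k := by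
        simp_rw [expCoeff_mul_subst constantCoeff_X, expCoeff_tridiagonalOperator_dividedPow]
    _ = _ := (sum_range_eq_of_le hN fun l hl => by
        rw [expRiordan_eq_zero constantCoeff_X ω hl, zero_mul]).symm

theorem shefferProduction_eq_zero (a b c : R) (ω : PowerSeries R) {k l : ℕ} (hkl : k + 1 < l) :
    shefferProduction a b c ω k l = 0 := by
  obtain ⟨N, hN⟩ := (isFiniteProd_shefferProduction a b c ω k l).exists
  rw [hN]
  refine sum_eq_zero fun i _ => ?_
  rcases Nat.lt_or_ge k i with hi | hi
  · rw [expRiordan_eq_zero constantCoeff_X ω hi, zero_mul]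
  · rw [shefferTridiagonal, of_apply, if_neg (by omega), if_neg (by omega), if_neg (by omega),
      mul_zero]

variable {S : Subsemiring R} {φ : PowerSeries R}

theorem minorsIn_expRiordan_rescale (hS : ∀ x : ℚ, 0 ≤ x → algebraMap ℚ R x ∈ S) (ha : a ∈ S)
    (hφ : MinorsIn S (toeplitzMatrix fun n => coeff n φ)) :
    MinorsIn S (expRiordan (rescale a φ) X) := by
  have htri : ∀ i j, i < j → toeplitzMatrix (fun n => coeff n φ) i j = 0 := fun i j hij =>
    if_neg (Nat.not_le.2 hij)
  convert (hφ.pow_sub_mul htri ha).row_column_scaling (x := fun n => (n.factorial : R))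
    (y := fun k => algebraMap ℚ R (1 / k.factorial)) (fun n => natCast_mem S _)
    (fun k => hS _ (by positivity)) using 1
  ext n k
  rw [expRiordan_eq, coeff_mul_X_pow', toeplitzMatrix, of_apply, of_apply, of_apply]
  split_ifs
  · rw [coeff_rescale]
  · simp only [mul_zero]

theorem minorsIn_shefferProduction (hS : ∀ x : ℚ, 0 ≤ x → algebraMap ℚ R x ∈ S) (ha : a ∈ S)
    (hb : b ∈ S) (hc : c ∈ S) (hφ : MinorsIn S (toeplitzMatrix fun n => coeff n φ)) {v : R}
    (hv : v ∈ S) : MinorsIn S (shefferProduction a b c (rescale v φ)) :=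
  (isFiniteProd_shefferProduction a b c _).minorsIn (minorsIn_expRiordan_rescale hS hv hφ)
    (minorsIn_shefferTridiagonal ha hb hc)

end ShefferSystem

section ShefferTriangle

open Finset Matrix PowerSeries

variable {R R' : Type*} [CommRing R] [CommRing R'] [Algebra ℚ R] [Algebra ℚ R']

theorem expRiordan_map (ψ : R →+* R') (H F : PowerSeries R) (n k : ℕ) :
    expRiordan (H.map ψ) (F.map ψ) n k = ψ (expRiordan H F n k) := by
  rw [expRiordan_eq, expRiordan_eq, ← map_pow, ← map_mul (PowerSeries.map ψ), coeff_map, map_mul ψ,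
    map_mul ψ, map_natCast, ψ.map_rat_algebraMap]

theorem expCoeff_mul_expSeries {F : PowerSeries R} (hF : constantCoeff F = 0) (H : PowerSeries R)
    (u : R) (n : ℕ) : expCoeff n (H * expSeries u F) =
      ∑ k ∈ range (n + 1), expRiordan H F n k * u ^ k := by
  rw [expSeries_eq_subst hF, expCoeff_mul_subst hF]
  refine sum_congr rfl fun k _ => ?_
  rw [expCoeff_apply, coeff_rescale, coeff_exp]
  linear_combination expRiordan H F n k * u ^ k *
    algebraMap_one_div_mul_natCast (R := R) k.factorial_ne_zero

theorem shefferPoly_eq_sum {F : PowerSeries R} (hF : constantCoeff F = 0) (G : PowerSeries R)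
    (n : ℕ) : shefferPoly F G n =
      ∑ k ∈ range (n + 1), Polynomial.C (expRiordan G F n k) * Polynomial.X ^ k := by
  have hF' : constantCoeff (F.map Polynomial.C) = 0 := by
    rw [constantCoeff_map, hF, map_zero]
  simp_rw [← expRiordan_map, ← expCoeff_mul_expSeries hF']
  rfl

theorem shefferTriangle_eq_expRiordan {F : PowerSeries R} (hF : constantCoeff F = 0)
    (G : PowerSeries R) : shefferTriangle F G = expRiordan G F := by
  ext n k
  simp only [shefferTriangle, of_apply, shefferPoly_eq_sum hF, Polynomial.finsetSum_coeff,
    Polynomial.coeff_C_mul_X_pow, sum_ite_eq, mem_range]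
  split_ifs with hk
  · rfl
  · rw [expRiordan_eq_zero hF G (by omega)]

/-- The bivariate homogenization `∑ₖ S_{n,k} u ^ k v ^ (n - k)` of the row polynomials of the
exponential Riordan array of `G` and `F`. -/
noncomputable def shefferForm (F G : PowerSeries R) (u v : R) (n : ℕ) : R :=
  ∑ k ∈ range (n + 1), expRiordan G F n k * u ^ k * v ^ (n - k)

theorem shefferForm_eq_expCoeff {F : PowerSeries R} (hF : constantCoeff F = 0) (G : PowerSeries R)
    (u v : R) (n : ℕ) :
    shefferForm F G u v n = expCoeff n (rescale v G * expSeries u (rescaleDiv v F)) := by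
  rw [expCoeff_mul_expSeries (constantCoeff_rescaleDiv hF v)]
  refine sum_congr rfl fun k _ => ?_
  rw [expRiordan_eq, expRiordan_eq, coeff_rescale_mul_rescaleDiv_pow hF]
  ring

theorem shefferSeq_eq_shefferForm {F : PowerSeries R} (hF : constantCoeff F = 0)
    (G : PowerSeries R) (q : R) : shefferSeq F G q = shefferForm F G q 1 := by
  ext n
  simp [shefferSeq, shefferPoly_eq_sum hF, shefferForm, Polynomial.eval_finsetSum]

theorem shefferRecipSeq_eq_shefferForm {F : PowerSeries R} (hF : constantCoeff F = 0)
    (G : PowerSeries R) (q : R) : shefferRecipSeq F G q = shefferForm F G 1 q := by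
  ext n
  have reflect_sum (p : ℕ → Polynomial R) (m : ℕ) :
      (∑ k ∈ range m, p k).reflect n = ∑ k ∈ range m, (p k).reflect n := by
    induction m with
    | zero => rfl
    | succ m ih => rw [sum_range_succ, sum_range_succ, Polynomial.reflect_add, ih]
  rw [shefferRecipSeq, shefferPoly_eq_sum hF, reflect_sum, Polynomial.eval_finsetSum]
  refine sum_congr rfl fun k hk => ?_
  rw [Polynomial.reflect_C_mul_X_pow, Polynomial.revAt_le (mem_range_succ_iff.1 hk)]
  simp

namespace IsShefferSystem

variable {S : Subsemiring R} {a b c : R} {φ F H : PowerSeries R}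

theorem minorsIn_expRiordan (h : IsShefferSystem a b c φ F H)
    (hS : ∀ x : ℚ, 0 ≤ x → algebraMap ℚ R x ∈ S) (ha : a ∈ S) (hb : b ∈ S) (hc : c ∈ S)
    (hφ : MinorsIn S (toeplitzMatrix fun n => coeff n φ)) : MinorsIn S (expRiordan H F) := by
  have hP := minorsIn_shefferProduction hS ha hb hc hφ S.one_mem
  rw [rescale_one, RingHom.id_apply] at hP
  exact h.isOutputMatrix.minorsIn hP

theorem minorsIn_hankel_shefferForm (h : IsShefferSystem a b c φ F H)
    (hS : ∀ x : ℚ, 0 ≤ x → algebraMap ℚ R x ∈ S) (ha : a ∈ S) (hb : b ∈ S) (hc : c ∈ S)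
    (hφ : MinorsIn S (toeplitzMatrix fun n => coeff n φ)) {u v : R} (hu : u ∈ S) (hv : v ∈ S) :
    MinorsIn S (hankelMatrix (shefferForm F H u v)) := by
  have hP := minorsIn_shefferProduction hS (mul_mem hv ha) (add_mem (mul_mem hv hb) hu)
    (mul_mem hv hc) hφ hv
  have hcol := ((h.rescale v).expSeries u).isOutputMatrix.minorsIn_hankel
    (fun _ _ => shefferProduction_eq_zero _ _ _ _) hP
  simp_rw [expRiordan_apply_zero, ← shefferForm_eq_expCoeff h.constantCoeff_left] at hcol
  exact hcol

theorem shefferG [BinomialRing R] (h : IsShefferSystem 1 0 0 φ F 1) (γ l : R) :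
    IsShefferSystem 1 l γ φ F (shefferG γ l F) := by
  have h' := (h.onePlusPow γ).expSeries l
  rwa [zero_add, zero_add, one_mul] at h'

end IsShefferSystem

end ShefferTriangle

section LogConvexity

open Matrix

variable {R : Type*} [CommRing R]

/-- The Hankel determinant of size `m` of the sequence `a` starting at the index `i`. -/
def hankelDet (a : ℕ → R) (m i : ℕ) : R :=
  (of fun p q : Fin m => a (i + p + q)).det

theorem MinorsIn.hankelDet_mem {S : Subsemiring R} {a : ℕ → R} (h : MinorsIn S (hankelMatrix a))
    (m i : ℕ) : hankelDet a m i ∈ S :=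
  h m (OrderEmbedding.ofStrictMono (fun p => i + p) fun _ _ hpq => Nat.add_lt_add_left hpq i)
    (Fin.valOrderEmb m)

theorem MinorsIn.hankelMatrix_succ {S : Subsemiring R} {a : ℕ → R}
    (h : MinorsIn S (hankelMatrix a)) : MinorsIn S (hankelMatrix fun n => a (n + 1)) := by
  convert h.submatrix (OrderEmbedding.ofStrictMono Nat.succ fun _ _ => Nat.succ_lt_succ)
    (RelEmbedding.refl _) using 1
  ext i j
  exact congrArg a (Nat.add_right_comm i j 1)

theorem hankelDet_one (a : ℕ → R) (i : ℕ) : hankelDet a 1 i = a i := by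
  rw [hankelDet, det_fin_one]
  rfl

theorem hankelDet_two (a : ℕ → R) (i : ℕ) :
    hankelDet a 2 i = a i * a (i + 2) - a (i + 1) ^ 2 := by
  rw [hankelDet, det_fin_two]
  simp only [of_apply, Fin.val_zero, Fin.val_one, add_zero, add_assoc, Nat.reduceAdd]
  ring

theorem hankelDet_three (a : ℕ → R) (i : ℕ) : hankelDet a 3 i =
    a i * (a (i + 2) * a (i + 4) - a (i + 3) ^ 2) -
      a (i + 1) * (a (i + 1) * a (i + 4) - a (i + 2) * a (i + 3)) +
      a (i + 2) * (a (i + 1) * a (i + 3) - a (i + 2) ^ 2) := by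
  rw [hankelDet, det_fin_three]
  simp only [of_apply, Fin.val_zero, Fin.val_one, Fin.val_two, add_zero, add_assoc, Nat.reduceAdd]
  ring

/-- The Desnanot-Jacobi identity for a Hankel determinant of size `4`. -/
theorem hankelDet_four_mul_hankelDet_two (a : ℕ → R) (i : ℕ) :
    hankelDet a 4 i * hankelDet a 2 (i + 2) =
      hankelDet a 3 i * hankelDet a 3 (i + 2) - hankelDet a 3 (i + 1) ^ 2 := by
  simp only [hankelDet_two, hankelDet_three]
  rw [hankelDet, det_succ_row_zero]
  simp only [Fin.sum_univ_succ, det_fin_three]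
  simp [Fin.succAbove, add_assoc, Fin.lt_def]
  ring

theorem logConvexOp_eq_hankelDet (a : ℕ → R) (i : ℕ) : logConvexOp a i = hankelDet a 2 i :=
  (hankelDet_two a i).symm

theorem logConvexOp_iterate_two (a : ℕ → R) (i : ℕ) :
    (logConvexOp^[2] a) i = hankelDet a 1 (i + 2) * hankelDet a 3 i := by
  rw [hankelDet_one, hankelDet_three]
  simp only [Function.iterate_succ, Function.iterate_zero, Function.comp, id, logConvexOp,
    add_assoc, Nat.reduceAdd]
  ring

theorem logConvexOp_iterate_three (a : ℕ → R) (i : ℕ) : (logConvexOp^[3] a) i =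
    hankelDet a 2 (i + 2) * (hankelDet a 3 i * hankelDet a 3 (i + 2)) +
      hankelDet a 1 (i + 3) ^ 2 * (hankelDet a 4 i * hankelDet a 2 (i + 2)) := by
  rw [Function.iterate_succ_apply', hankelDet_four_mul_hankelDet_two, hankelDet_two, logConvexOp]
  simp only [logConvexOp_iterate_two, hankelDet_one, add_assoc, Nat.reduceAdd]
  ring

theorem MinorsIn.iterate_logConvexOp_mem {S : Subsemiring R} {a : ℕ → R}
    (h : MinorsIn S (hankelMatrix a)) {m : ℕ} (hm : m ≤ 3) (i : ℕ) :
    (logConvexOp^[m] a) i ∈ S := by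
  have hdet := h.hankelDet_mem
  interval_cases m
  · rw [Function.iterate_zero, id, ← hankelDet_one a i]
    exact hdet 1 i
  · rw [Function.iterate_one, logConvexOp_eq_hankelDet]
    exact hdet 2 i
  · rw [logConvexOp_iterate_two]
    exact mul_mem (hdet 1 _) (hdet 3 _)
  · rw [logConvexOp_iterate_three]
    exact add_mem (mul_mem (hdet 2 _) (mul_mem (hdet 3 _) (hdet 3 _)))
      (mul_mem (pow_mem (hdet 1 _) 2) (mul_mem (hdet 4 _) (hdet 2 _)))

theorem isKLogConvex_three_of_isTP_hankel {a : ℕ → ℝ} (h : IsTP (hankelMatrix a)) :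
    IsKLogConvex 3 a := fun _ hm i =>
  MinorsIn.iterate_logConvexOp_mem (isTP_iff_minorsIn.1 h) hm i

theorem isKCoeffLogConvex_three_of_isCoeffSM {σ : Type*} {a : ℕ → MvPolynomial σ ℝ}
    (h : IsCoeffSM a) : IsKCoeffLogConvex 3 a := fun _ hm i =>
  MinorsIn.iterate_logConvexOp_mem (isCoeffTP_iff_minorsIn.1 h) hm i

end LogConvexity

section DerivativeSequence

open Finset Matrix PowerSeries Filter Topology

theorem isTP_of_tendsto {ι : Type*} {l : Filter ι} [l.NeBot] {M : ι → Matrix ℕ ℕ ℝ}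
    {L : Matrix ℕ ℕ ℝ} (hM : ∀ᶠ q in l, IsTP (M q))
    (hL : ∀ i j, Tendsto (fun q => M q i j) l (𝓝 (L i j))) : IsTP L := fun m r c => by
  have hdet : Continuous fun A : Matrix (Fin m) (Fin m) ℝ => A.det := continuous_id.matrix_det
  have hsub : Tendsto (fun q => (M q).submatrix r c) l (𝓝 (L.submatrix r c)) :=
    tendsto_pi_nhds.2 fun i => tendsto_pi_nhds.2 fun j => hL (r i) (c j)
  exact ge_of_tendsto ((hdet.tendsto _).comp hsub) (hM.mono fun q hq => hq m r c)

theorem shefferForm_one_succ (F : PowerSeries ℝ) (q : ℝ) (n : ℕ) :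
    shefferForm F 1 q 1 (n + 1) =
      (∑ k ∈ range (n + 1), expRiordan 1 F (n + 1) (k + 1) * q ^ k) * q := by
  rw [shefferForm, sum_range_succ', expRiordan_apply_zero, expCoeff_apply, coeff_one,
    if_neg n.succ_ne_zero, sum_mul]
  simp [pow_succ, mul_assoc]

theorem isTP_hankel_derivative {φ f : PowerSeries ℝ} (h : IsShefferSystem 1 0 0 φ f 1)
    (hφ : IsPF φ) :
    IsTP (hankelMatrix fun n => ((n + 1).factorial : ℝ) * coeff (n + 1) f) := by
  have hform (q : ℝ) (hq : 0 < q) :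
      IsTP (hankelMatrix fun n => q⁻¹ * shefferForm f 1 q 1 (n + 1)) := by
    have hH : MinorsIn (Subsemiring.nonneg ℝ) (hankelMatrix (shefferForm f 1 q 1)) :=
      h.minorsIn_hankel_shefferForm (fun x hx => by simpa using hx) (one_mem _) (zero_mem _)
        (zero_mem _) (isTP_iff_minorsIn.1 hφ) hq.le (one_mem _)
    refine isTP_iff_minorsIn.2 ?_
    convert hH.hankelMatrix_succ.row_column_scaling (x := fun _ => q⁻¹) (y := fun _ => 1)
      (fun _ => (inv_pos.2 hq).le) (fun _ => one_mem _) using 1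
    ext i j
    simp [hankelMatrix]
  refine isTP_of_tendsto (l := 𝓝[>] 0) (eventually_mem_nhdsWithin.mono hform) fun i j => ?_
  have hcont : Continuous fun q : ℝ =>
      ∑ k ∈ range (i + j + 1), expRiordan 1 f (i + j + 1) (k + 1) * q ^ k := by fun_prop
  have hlim := (hcont.tendsto 0).mono_left (nhdsWithin_le_nhds (s := Set.Ioi 0))
  rw [sum_range_succ'] at hlim
  simp only [pow_succ, mul_zero, sum_const_zero, pow_zero, mul_one, zero_add] at hlim
  have hone : expRiordan 1 f (i + j + 1) 1 = ((i + j + 1).factorial : ℝ) * coeff (i + j + 1) f := by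
    rw [expRiordan_eq]
    simp
  refine (hone ▸ hlim).congr' (eventually_mem_nhdsWithin.mono fun q hq => ?_)
  have hq0 : q ≠ 0 := ne_of_gt hq
  simp only [hankelMatrix, of_apply, shefferForm_one_succ]
  field_simp

end DerivativeSequence

section PrincipalMinors

open Finset Matrix Polynomial

variable {n : Type*} [DecidableEq n]

theorem neg_one_pow_mul_eval_neg_charpoly [Fintype n] {R : Type*} [CommRing R] (A : Matrix n n R)
    (x : R) :
    (-1) ^ Fintype.card n * A.charpoly.eval (-x) =
      ∑ k ∈ range (Fintype.card n + 1), (∑ s ∈ univ.powersetCard k,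
        (A.submatrix (Subtype.val : s → n) Subtype.val).det) * x ^ (Fintype.card n - k) := by
  nontriviality R
  rw [eval_eq_sum_range, charpoly_natDegree_eq_dim, ← sum_range_reflect, mul_sum]
  refine sum_congr rfl fun k hk => ?_
  have hk' : k ≤ Fintype.card n := Nat.lt_succ_iff.1 (mem_range.1 hk)
  have hsign : (-1 : R) ^ Fintype.card n * (-1) ^ k * (-1) ^ (Fintype.card n - k) = 1 := by
    rw [mul_assoc, ← pow_add, Nat.add_sub_cancel' hk', ← mul_pow]
    simp
  rw [Nat.add_sub_cancel, charpoly_coeff_eq_sum_minors A k hk', neg_pow x]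
  linear_combination (∑ s ∈ univ.powersetCard k,
    (A.submatrix (Subtype.val : s → n) Subtype.val).det) * x ^ (Fintype.card n - k) * hsign

theorem posSemidef_of_principal_minors_nonneg [Finite n] {A : Matrix n n ℝ} (hA : A.IsHermitian)
    (h : ∀ s : Finset n, 0 ≤ (A.submatrix (Subtype.val : s → n) Subtype.val).det) :
    A.PosSemidef := by
  cases nonempty_fintype n
  refine hA.posSemidef_iff_eigenvalues_nonneg.2 fun i => not_lt.1 fun hi => ?_
  have hx : 0 < -hA.eigenvalues i := neg_pos.2 hi
  have hroot : A.charpoly.eval (- -hA.eigenvalues i) = 0 := by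
    rw [neg_neg, hA.charpoly_eq, eval_prod]
    exact prod_eq_zero (mem_univ i) (by simp)
  have hpos : 0 < ∑ k ∈ range (Fintype.card n + 1), (∑ s ∈ univ.powersetCard k,
      (A.submatrix (Subtype.val : s → n) Subtype.val).det) *
        (-hA.eigenvalues i) ^ (Fintype.card n - k) := by
    refine sum_pos' (fun k _ => mul_nonneg (sum_nonneg fun s _ => h s) (pow_nonneg hx.le _))
      ⟨0, by simp, ?_⟩
    simpa using pow_pos hx _
  rw [← neg_one_pow_mul_eval_neg_charpoly, hroot, mul_zero] at hpos
  exact hpos.false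

end PrincipalMinors

section HalfLinePolynomials

open Polynomial Filter Topology

/-- The polynomials `s + X * t` with `s` and `t` sums of squares. They are evidently nonnegative
on `[0, ∞)`, and every polynomial nonnegative on `[0, ∞)` is of this form. -/
def halfLinePreordering : Subsemiring ℝ[X] where
  carrier := {p | ∃ s t : ℝ[X], IsSumSq s ∧ IsSumSq t ∧ p = s + X * t}
  zero_mem' := ⟨0, 0, .zero, .zero, by simp⟩
  one_mem' := ⟨1, 0, .one, .zero, by simp⟩
  add_mem' := by
    rintro _ _ ⟨s, t, hs, ht, rfl⟩ ⟨s', t', hs', ht', rfl⟩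
    exact ⟨s + s', t + t', hs.add hs', ht.add ht', by ring⟩
  mul_mem' := by
    rintro _ _ ⟨s, t, hs, ht, rfl⟩ ⟨s', t', hs', ht', rfl⟩
    exact ⟨s * s' + X * X * (t * t'), s * t' + t * s',
      (hs.mul hs').add ((IsSumSq.mul_self X).mul (ht.mul ht')),
      (hs.mul ht').add (ht.mul hs'), by ring⟩

theorem sq_mem_halfLinePreordering (p : ℝ[X]) : p ^ 2 ∈ halfLinePreordering :=
  ⟨p ^ 2, 0, (IsSquare.sq p).isSumSq, .zero, by simp⟩

theorem X_mem_halfLinePreordering : X ∈ halfLinePreordering :=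
  ⟨0, 1, .zero, .one, by simp⟩

theorem C_mem_halfLinePreordering {c : ℝ} (hc : 0 ≤ c) : C c ∈ halfLinePreordering := by
  rw [← Real.sq_sqrt hc, C_pow]
  exact sq_mem_halfLinePreordering _

theorem eval_nonneg_of_mem_halfLinePreordering {p : ℝ[X]} (hp : p ∈ halfLinePreordering) {x : ℝ}
    (hx : 0 ≤ x) : 0 ≤ p.eval x := by
  obtain ⟨s, t, hs, ht, rfl⟩ := hp
  have hnonneg {q : ℝ[X]} (hq : IsSumSq q) : 0 ≤ q.eval x := by
    induction hq with
    | zero => simp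
    | sq_add a _ ih =>
      rw [eval_add, eval_mul]
      exact add_nonneg (mul_self_nonneg _) ih
  rw [eval_add, eval_mul, eval_X]
  exact add_nonneg (hnonneg hs) (mul_nonneg hx (hnonneg ht))

theorem eval_nonneg_of_eval_mul_nonneg {p q : ℝ[X]} (hq0 : q ≠ 0)
    (hq : ∀ x, 0 ≤ x → 0 ≤ q.eval x) (h : ∀ x, 0 ≤ x → 0 ≤ (q * p).eval x) (x : ℝ) (hx : 0 ≤ x) :
    0 ≤ p.eval x := by
  by_contra! hneg
  have hroots : {y | q.IsRoot y} ∈ 𝓝[>] x := by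
    filter_upwards [nhdsWithin_le_nhds (p.continuous.continuousAt.eventually_lt_const hneg),
      self_mem_nhdsWithin] with y hpy hxy
    have hy : 0 ≤ y := hx.trans (le_of_lt hxy)
    have hqp := h y hy
    rw [eval_mul] at hqp
    exact le_antisymm (nonpos_of_mul_nonneg_left hqp hpy) (hq y hy)
  obtain ⟨u, hu, hsub⟩ := mem_nhdsGT_iff_exists_Ioo_subset.1 hroots
  exact hq0 (eq_zero_of_infinite_isRoot q ((Set.Ioo_infinite hu).mono hsub))

theorem sq_X_sub_C_dvd_of_nonneg {p : ℝ[X]} (hp : ∀ x, 0 ≤ x → 0 ≤ p.eval x) {r : ℝ} (hr : 0 < r)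
    (hroot : p.IsRoot r) : (X - C r) ^ 2 ∣ p := by
  rcases eq_or_ne p 0 with rfl | hp0
  · exact dvd_zero _
  have hmin : IsLocalMin (fun x => p.eval x) r := by
    filter_upwards [eventually_gt_nhds hr] with x hx
    rw [hroot.eq_zero]
    exact hp x hx.le
  have hderiv : (derivative p).IsRoot r := by
    rw [IsRoot, ← Polynomial.deriv]
    exact hmin.deriv_eq_zero
  rw [← le_rootMultiplicity_iff hp0]
  exact (one_lt_rootMultiplicity_iff_isRoot hp0).2 ⟨hroot, hderiv⟩

theorem exists_dvd_mem_halfLinePreordering {p : ℝ[X]} (hp : ∀ x, 0 ≤ x → 0 ≤ p.eval x)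
    (hdeg : 0 < p.degree) : ∃ q ∈ halfLinePreordering, q ∣ p ∧ 0 < q.natDegree := by
  obtain ⟨z, hz⟩ := Complex.exists_root (f := p.map (algebraMap ℝ ℂ)) (by rwa [degree_map])
  rw [IsRoot, eval_map_algebraMap] at hz
  by_cases him : z.im = 0
  · obtain ⟨r, rfl⟩ : ∃ r : ℝ, z = r := ⟨z.re, Complex.ext rfl him⟩
    have hroot : p.IsRoot r := by
      rw [← Complex.coe_algebraMap, aeval_algebraMap_apply, map_eq_zero_iff _
        (algebraMap ℝ ℂ).injective] at hz
      exact hz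
    rcases lt_or_ge 0 r with hr | hr
    · exact ⟨_, sq_mem_halfLinePreordering (X - C r), sq_X_sub_C_dvd_of_nonneg hp hr hroot,
        by simp⟩
    · refine ⟨X + C (-r), add_mem X_mem_halfLinePreordering
        (C_mem_halfLinePreordering (neg_nonneg.2 hr)), ?_, ?_⟩
      · rw [C_neg, ← sub_eq_add_neg]
        exact dvd_iff_isRoot.2 hroot
      · rw [natDegree_X_add_C]
        exact one_pos
  · have hsq : X ^ 2 - C (2 * z.re) * X + C (‖z‖ ^ 2) = (X - C z.re) ^ 2 + C (z.im ^ 2) := by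
      rw [Complex.sq_norm, Complex.normSq_apply]
      simp only [map_mul, map_add, map_pow, map_ofNat]
      ring
    have hdvd := p.quadratic_dvd_of_aeval_eq_zero_im_ne_zero hz him
    rw [hsq] at hdvd
    refine ⟨_, add_mem (sq_mem_halfLinePreordering _)
      (C_mem_halfLinePreordering (sq_nonneg z.im)), hdvd, ?_⟩
    rw [natDegree_add_C]
    simp

theorem mem_halfLinePreordering_iff {p : ℝ[X]} :
    p ∈ halfLinePreordering ↔ ∀ x, 0 ≤ x → 0 ≤ p.eval x := by
  refine ⟨fun hp x => eval_nonneg_of_mem_halfLinePreordering hp, fun hp => ?_⟩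
  induction hd : p.natDegree using Nat.strong_induction_on generalizing p with
  | _ d ih =>
    rcases le_or_gt p.degree 0 with hdeg | hdeg
    · rw [eq_C_of_degree_le_zero hdeg, coeff_zero_eq_eval_zero]
      exact C_mem_halfLinePreordering (hp 0 le_rfl)
    · obtain ⟨q, hq, ⟨s, rfl⟩, hqdeg⟩ := exists_dvd_mem_halfLinePreordering hp hdeg
      have hq0 : q ≠ 0 := ne_zero_of_natDegree_gt hqdeg
      have hs0 : s ≠ 0 := right_ne_zero_of_mul (ne_zero_of_degree_gt hdeg)
      rw [natDegree_mul hq0 hs0] at hd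
      exact mul_mem hq (ih s.natDegree (by omega) (eval_nonneg_of_eval_mul_nonneg hq0
        (fun x => eval_nonneg_of_mem_halfLinePreordering hq) hp) rfl)

end HalfLinePolynomials

section StieltjesMomentProblem

open Finset Matrix Polynomial MeasureTheory Filter Topology CompactlySupported
open scoped NNReal ENNReal

/-- The linear functional on `ℝ[X]` that sends `X ^ n` to `a n`. -/
noncomputable def momentFunctional (a : ℕ → ℝ) : ℝ[X] →ₗ[ℝ] ℝ :=
  lsum fun n => LinearMap.toSpanSingleton ℝ ℝ (a n)

theorem momentFunctional_apply (a : ℕ → ℝ) (p : ℝ[X]) :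
    momentFunctional a p = ∑ n ∈ range (p.natDegree + 1), p.coeff n * a n :=
  p.sum_over_range fun n => zero_mul (a n)

theorem momentFunctional_monomial (a : ℕ → ℝ) (n : ℕ) (c : ℝ) :
    momentFunctional a (monomial n c) = c * a n :=
  sum_monomial_index _ _ (zero_mul _)

theorem momentFunctional_X_mul (a : ℕ → ℝ) (p : ℝ[X]) :
    momentFunctional a (X * p) = momentFunctional (fun n => a (n + 1)) p := by
  induction p using Polynomial.induction_on' with
  | add p q hp hq => rw [mul_add, map_add, map_add, hp, hq]
  | monomial n c => rw [X_mul_monomial, momentFunctional_monomial, momentFunctional_monomial]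

theorem momentFunctional_integral {Ω : Type*} [MeasurableSpace Ω] {μ : Measure Ω}
    {a : Ω → ℕ → ℝ} (ha : ∀ n, Integrable (fun ω => a ω n) μ) (p : ℝ[X]) :
    momentFunctional (fun n => ∫ ω, a ω n ∂μ) p = ∫ ω, momentFunctional (a ω) p ∂μ := by
  simp only [momentFunctional_apply]
  rw [integral_finsetSum _ fun n _ => (ha n).const_mul _]
  simp only [integral_const_mul]

theorem IsStieltjesMoment.momentFunctional_nonneg {a : ℕ → ℝ} (ha : IsStieltjesMoment a) {p : ℝ[X]}
    (hp : ∀ x, 0 ≤ x → 0 ≤ p.eval x) : 0 ≤ momentFunctional a p := by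
  obtain ⟨μ, hμ0, hμ⟩ := ha
  have hae : ∀ᵐ x ∂μ, 0 ≤ x := by simpa [ae_iff, ← Set.Iio_def] using hμ0
  have ha : a = fun n => ∫ x, x ^ n ∂μ := funext fun n => (hμ n).2
  rw [ha, momentFunctional_integral fun n => (hμ n).1]
  refine integral_nonneg_of_ae (hae.mono fun x hx => ?_)
  change (0 : ℝ) ≤ momentFunctional (x ^ ·) p
  rw [momentFunctional_apply, ← eval_eq_sum_range]
  exact hp x hx

section Extension

/-- The cone of the pairs `(p, g)` such that `p + g` is nonnegative on `[0, ∞)`. -/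
def halfLineNonnegCone : PointedCone ℝ (ℝ[X] × C_c(ℝ≥0, ℝ)) where
  carrier := {e | ∀ x : ℝ≥0, 0 ≤ e.1.eval (x : ℝ) + e.2 x}
  zero_mem' := fun x => by simp
  add_mem' := fun {e e'} he he' x => by
    simpa [add_add_add_comm] using add_nonneg (he x) (he' x)
  smul_mem' := fun c e he x => by
    suffices 0 ≤ c • (e.1.eval (x : ℝ) + e.2 x) by simpa [smul_add]
    exact mul_nonneg c.2 (he x)

/-- M. Riesz's extension theorem applies because a compactly supported function is bounded by a
constant polynomial. -/
theorem exists_positive_extension {L : ℝ[X] →ₗ[ℝ] ℝ}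
    (hL : ∀ p : ℝ[X], (∀ x, 0 ≤ x → 0 ≤ p.eval x) → 0 ≤ L p) :
    ∃ G : ℝ[X] × C_c(ℝ≥0, ℝ) →ₗ[ℝ] ℝ,
      (∀ p, G (p, 0) = L p) ∧ ∀ e ∈ halfLineNonnegCone, 0 ≤ G e := by
  let f : ℝ[X] × C_c(ℝ≥0, ℝ) →ₗ.[ℝ] ℝ :=
    ⟨Submodule.prod ⊤ ⊥, (L ∘ₗ LinearMap.fst ℝ _ _).domRestrict _⟩
  have hf : ∀ e : f.domain, (e : ℝ[X] × C_c(ℝ≥0, ℝ)) ∈ halfLineNonnegCone → 0 ≤ f e := by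
    rintro ⟨⟨p, g⟩, _, rfl : g = 0⟩ he
    exact hL p fun x hx => (he ⟨x, hx⟩).trans_eq (add_zero _)
  have hdense : ∀ e, ∃ q : f.domain, (q : ℝ[X] × C_c(ℝ≥0, ℝ)) + e ∈ halfLineNonnegCone := by
    rintro ⟨p, g⟩
    obtain ⟨B, hB⟩ := g.hasCompactSupport.exists_bound_of_continuous g.continuous
    refine ⟨⟨(C B - p, 0), trivial, rfl⟩, fun x => ?_⟩
    simpa [neg_le_iff_add_nonneg'] using neg_le_of_abs_le (hB x)
  obtain ⟨G, hG, hpos⟩ := riesz_extension halfLineNonnegCone f hf hdense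
  exact ⟨G, fun p => hG ⟨(p, 0), trivial, rfl⟩, hpos⟩

theorem exists_positiveLinearMap_dominated {L : ℝ[X] →ₗ[ℝ] ℝ}
    (hL : ∀ p : ℝ[X], (∀ x, 0 ≤ x → 0 ≤ p.eval x) → 0 ≤ L p) :
    ∃ Λ : C_c(ℝ≥0, ℝ) →ₚ[ℝ] ℝ, ∀ (g : C_c(ℝ≥0, ℝ)) (p : ℝ[X]),
      ((∀ x : ℝ≥0, g x ≤ p.eval (x : ℝ)) → Λ g ≤ L p) ∧
        ((∀ x : ℝ≥0, p.eval (x : ℝ) ≤ g x) → L p ≤ Λ g) := by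
  obtain ⟨G, hG, hpos⟩ := exists_positive_extension hL
  have hsub (p : ℝ[X]) (g : C_c(ℝ≥0, ℝ)) : G (p, -g) = L p - G (0, g) := by
    rw [← hG p, ← map_sub]
    simp
  refine ⟨PositiveLinearMap.mk₀ (G ∘ₗ LinearMap.inr ℝ _ _) fun g hg => hpos _ fun x => ?_,
    fun g p => ⟨fun h => ?_, fun h => ?_⟩⟩
  · simpa using hg x
  · have := hpos (p, -g) fun x => by simpa using h x
    rw [hsub] at this
    exact sub_nonneg.1 this
  · have := hpos (-(p, -g)) fun x => by simpa using h x
    rw [map_neg, hsub] at this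
    exact sub_nonpos.1 (neg_nonneg.1 this)

end Extension

section Cutoff

/-- The monomial `x ^ k` on `[0, ∞)`, cut off by the factor `max 0 (1 - x / (r + 1))`, which
increases to `1` with `r`. -/
noncomputable def cutoffPow (r k : ℕ) : C_c(ℝ≥0, ℝ) where
  toFun x := (x : ℝ) ^ k * max (0 : ℝ) (1 - (x : ℝ) / (r + 1))
  hasCompactSupport' := by
    refine HasCompactSupport.intro (K := Set.Icc 0 ((r : ℝ≥0) + 1)) isCompact_Icc fun x hx => ?_
    have hx' : (r : ℝ) + 1 < x := by
      exact_mod_cast not_le.1 fun h => hx ⟨zero_le, h⟩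
    have hneg : 1 - (x : ℝ) / (r + 1) ≤ 0 := by
      rw [sub_nonpos, one_le_div (by positivity)]
      exact hx'.le
    rw [max_eq_left hneg, mul_zero]

theorem cutoffPow_apply (r k : ℕ) (x : ℝ≥0) :
    cutoffPow r k x = (x : ℝ) ^ k * max (0 : ℝ) (1 - (x : ℝ) / (r + 1)) := rfl

theorem cutoffPow_nonneg (r k : ℕ) (x : ℝ≥0) : 0 ≤ cutoffPow r k x :=
  mul_nonneg (by positivity) (le_max_left _ _)

theorem cutoffPow_le_pow (r k : ℕ) (x : ℝ≥0) : cutoffPow r k x ≤ (x : ℝ) ^ k :=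
  mul_le_of_le_one_right (by positivity) (max_le zero_le_one (sub_le_self 1 (by positivity)))

theorem pow_sub_le_cutoffPow (r k : ℕ) (x : ℝ≥0) :
    (x : ℝ) ^ k - x ^ (k + 1) / (r + 1) ≤ cutoffPow r k x :=
  calc (x : ℝ) ^ k - x ^ (k + 1) / (r + 1) = x ^ k * (1 - x / (r + 1)) := by ring
    _ ≤ cutoffPow r k x := mul_le_mul_of_nonneg_left (le_max_right _ _) (by positivity)

theorem cutoffPow_mono (k : ℕ) (x : ℝ≥0) : Monotone fun r => cutoffPow r k x := fun r s hrs => by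
  simp only [cutoffPow_apply]
  gcongr

theorem tendsto_cutoffPow_bound (a b : ℝ) :
    Tendsto (fun r : ℕ => a - b / (r + 1)) atTop (𝓝 a) := by
  simpa [div_eq_mul_inv] using
    (tendsto_one_div_add_atTop_nhds_zero_nat.const_mul b).const_sub a

theorem tendsto_cutoffPow (k : ℕ) (x : ℝ≥0) :
    Tendsto (fun r => cutoffPow r k x) atTop (𝓝 ((x : ℝ) ^ k)) :=
  tendsto_of_tendsto_of_tendsto_of_le_of_le (tendsto_cutoffPow_bound _ _) tendsto_const_nhds
    (pow_sub_le_cutoffPow · k x) (cutoffPow_le_pow · k x)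

end Cutoff

theorem lintegral_pow_of_tendsto_cutoffPow {μ : Measure ℝ≥0} [IsFiniteMeasureOnCompacts μ] {k : ℕ}
    {c : ℝ} (h : Tendsto (fun r => ∫ x, cutoffPow r k x ∂μ) atTop (𝓝 c)) :
    ∫⁻ x : ℝ≥0, ENNReal.ofReal ((x : ℝ) ^ k) ∂μ = ENNReal.ofReal c := by
  have hcut (r : ℕ) : ∫⁻ x, ENNReal.ofReal (cutoffPow r k x) ∂μ =
      ENNReal.ofReal (∫ x, cutoffPow r k x ∂μ) :=
    (ofReal_integral_eq_lintegral_ofReal (cutoffPow r k).integrable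
      (Eventually.of_forall (cutoffPow_nonneg r k))).symm
  have hmono : Tendsto (fun r => ∫⁻ x, ENNReal.ofReal (cutoffPow r k x) ∂μ) atTop
      (𝓝 (∫⁻ x : ℝ≥0, ENNReal.ofReal ((x : ℝ) ^ k) ∂μ)) :=
    lintegral_tendsto_of_tendsto_of_monotone
      (fun r => (cutoffPow r k).continuous.measurable.ennreal_ofReal.aemeasurable)
      (Eventually.of_forall fun x _ _ hrs => ENNReal.ofReal_le_ofReal (cutoffPow_mono k x hrs))
      (Eventually.of_forall fun x => ENNReal.tendsto_ofReal (tendsto_cutoffPow k x))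
  simp only [hcut] at hmono
  exact tendsto_nhds_unique hmono (ENNReal.tendsto_ofReal h)

theorem isStieltjesMoment_of_lintegral_pow {μ : Measure ℝ≥0} {a : ℕ → ℝ} (ha : ∀ k, 0 ≤ a k)
    (h : ∀ k, ∫⁻ x : ℝ≥0, ENNReal.ofReal ((x : ℝ) ^ k) ∂μ = ENNReal.ofReal (a k)) :
    IsStieltjesMoment a := by
  have hcoe : Measurable ((↑) : ℝ≥0 → ℝ) := measurable_coe_nnreal_real
  have hnonneg (k : ℕ) : 0 ≤ᵐ[μ] fun x : ℝ≥0 => (x : ℝ) ^ k :=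
    Eventually.of_forall fun x => pow_nonneg x.2 k
  have hmeas (k : ℕ) : AEStronglyMeasurable (fun x : ℝ≥0 => (x : ℝ) ^ k) μ := by fun_prop
  have hInt (k : ℕ) : Integrable (fun x : ℝ≥0 => (x : ℝ) ^ k) μ := by
    refine (lintegral_ofReal_ne_top_iff_integrable (hmeas k) (hnonneg k)).1 ?_
    rw [h k]
    exact ENNReal.ofReal_ne_top
  refine ⟨μ.map (↑), ?_, fun k => ⟨?_, ?_⟩⟩
  · rw [Measure.map_apply hcoe measurableSet_Iio]
    convert measure_empty (μ := μ)
    ext x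
    simp
  · exact (integrable_map_measure (by fun_prop) hcoe.aemeasurable).2 (hInt k)
  · rw [integral_map hcoe.aemeasurable (by fun_prop),
      integral_eq_lintegral_of_nonneg_ae (hnonneg k) (hmeas k), h k, ENNReal.toReal_ofReal (ha k)]

/-- Haviland's theorem for the half-line. -/
theorem isStieltjesMoment_iff_momentFunctional_nonneg {a : ℕ → ℝ} : IsStieltjesMoment a ↔
    ∀ p : ℝ[X], (∀ x, 0 ≤ x → 0 ≤ p.eval x) → 0 ≤ momentFunctional a p := by
  refine ⟨fun ha p => ha.momentFunctional_nonneg, fun ha => ?_⟩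
  have hX (k : ℕ) : momentFunctional a (X ^ k) = a k := by
    rw [← monomial_one_right_eq_X_pow, momentFunctional_monomial, one_mul]
  obtain ⟨Λ, hΛ⟩ := exists_positiveLinearMap_dominated ha
  have hupper (k r : ℕ) : Λ (cutoffPow r k) ≤ a k := by
    rw [← hX]
    exact (hΛ _ _).1 fun x => by simpa using cutoffPow_le_pow r k x
  have hlower (k r : ℕ) : a k - a (k + 1) / (r + 1) ≤ Λ (cutoffPow r k) := by
    have := (hΛ (cutoffPow r k) (X ^ k - ((r : ℝ) + 1)⁻¹ • X ^ (k + 1))).2 fun x => by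
      simpa [div_eq_inv_mul] using pow_sub_le_cutoffPow r k x
    simpa [hX, div_eq_inv_mul] using this
  refine isStieltjesMoment_of_lintegral_pow (μ := RealRMK.rieszMeasure Λ) (fun k => ?_) fun k =>
    lintegral_pow_of_tendsto_cutoffPow ?_
  · rw [← hX]
    exact ha _ fun x hx => by simpa using pow_nonneg hx k
  · simp only [RealRMK.integral_rieszMeasure]
    exact tendsto_of_tendsto_of_tendsto_of_le_of_le (tendsto_cutoffPow_bound _ _)
      tendsto_const_nhds (hlower k) (hupper k)

section TotallyPositiveHankel

theorem posSemidef_hankel_of_isTP {a : ℕ → ℝ} (h : IsTP (hankelMatrix a)) (N : ℕ) :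
    (of fun i j : Fin N => a (i + j)).PosSemidef := by
  have hsymm : (of fun i j : Fin N => a (i + j)).IsHermitian := by
    ext i j
    simp [add_comm]
  refine posSemidef_of_principal_minors_nonneg hsymm fun s => ?_
  let e : Fin s.card ≃o s := s.orderIsoOfFin rfl
  let r : Fin s.card ↪o ℕ := e.toOrderEmbedding.trans
    ((OrderEmbedding.subtype (· ∈ s)).trans (Fin.valOrderEmb N))
  rw [← det_submatrix_equiv_self e.toEquiv]
  exact h s.card r r

theorem momentFunctional_mul_self (a : ℕ → ℝ) (p : ℝ[X]) :
    momentFunctional a (p * p) =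
      (fun i : Fin (p.natDegree + 1) => p.coeff i) ⬝ᵥ
        ((of fun i j : Fin (p.natDegree + 1) => a (i + j)) *ᵥ fun i => p.coeff i) := by
  conv_lhs => rw [p.as_sum_range, sum_range, sum_mul_sum]
  simp only [monomial_mul_monomial, map_sum, momentFunctional_monomial, dotProduct, mulVec,
    of_apply, mul_sum]
  exact sum_congr rfl fun i _ => sum_congr rfl fun j _ => by ring

theorem momentFunctional_nonneg_of_isSumSq {a : ℕ → ℝ} (h : IsTP (hankelMatrix a)) {p : ℝ[X]}
    (hp : IsSumSq p) : 0 ≤ momentFunctional a p := by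
  induction hp with
  | zero => rw [map_zero]
  | sq_add q _ ih =>
    rw [map_add, momentFunctional_mul_self]
    exact add_nonneg ((posSemidef_hankel_of_isTP h _).dotProduct_mulVec_nonneg _) ih

theorem isStieltjesMoment_of_isTP_hankel {a : ℕ → ℝ} (h : IsTP (hankelMatrix a)) :
    IsStieltjesMoment a := by
  refine isStieltjesMoment_iff_momentFunctional_nonneg.2 fun p hp => ?_
  obtain ⟨s, t, hs, ht, rfl⟩ := mem_halfLinePreordering_iff.2 hp
  have hshift : IsTP (hankelMatrix fun n => a (n + 1)) :=
    isTP_iff_minorsIn.2 (isTP_iff_minorsIn.1 h).hankelMatrix_succ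
  rw [map_add, momentFunctional_X_mul]
  exact add_nonneg (momentFunctional_nonneg_of_isSumSq h hs)
    (momentFunctional_nonneg_of_isSumSq hshift ht)

end TotallyPositiveHankel

section Convolution

theorem isStieltjesMoment_integral {Ω : Type*} [MeasurableSpace Ω] {μ : Measure Ω} {a : Ω → ℕ → ℝ}
    (hint : ∀ n, Integrable (fun ω => a ω n) μ) (ha : ∀ᵐ ω ∂μ, IsStieltjesMoment (a ω)) :
    IsStieltjesMoment fun n => ∫ ω, a ω n ∂μ := by
  refine isStieltjesMoment_iff_momentFunctional_nonneg.2 fun p hp => ?_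
  rw [momentFunctional_integral hint]
  exact integral_nonneg_of_ae (ha.mono fun ω hω => hω.momentFunctional_nonneg hp)

theorem isStieltjesMoment_sum_mul {x : ℕ → ℝ} (hx : IsStieltjesMoment x) {B : Matrix ℕ ℕ ℝ}
    (hB : ∀ u, 0 ≤ u → IsStieltjesMoment fun n => ∑ k ∈ range (n + 1), B n k * u ^ k) :
    IsStieltjesMoment fun n => ∑ k ∈ range (n + 1), B n k * x k := by
  obtain ⟨μ, hμ0, hμ⟩ := hx
  have hae : ∀ᵐ u ∂μ, 0 ≤ u := by simpa [ae_iff, ← Set.Iio_def] using hμ0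
  have hint (n k : ℕ) : Integrable (fun u => B n k * u ^ k) μ := (hμ k).1.const_mul _
  convert isStieltjesMoment_integral (μ := μ)
    (fun n => integrable_finsetSum (range (n + 1)) fun k _ => hint n k) (hae.mono hB) with n
  rw [integral_finsetSum _ fun k _ => hint n k]
  simp only [integral_const_mul, ← (hμ _).2]

theorem isStieltjesMoment_triConvolution {A : Matrix ℕ ℕ ℝ}
    (hA : ∀ u v : ℝ, 0 ≤ u → 0 ≤ v →
      IsStieltjesMoment fun n => ∑ k ∈ range (n + 1), A n k * u ^ k * v ^ (n - k))
    {x y : ℕ → ℝ} (hx : IsStieltjesMoment x) (hy : IsStieltjesMoment y) :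
    IsStieltjesMoment (triConvolution A x y) := by
  have hreflect (c : ℕ → ℕ → ℝ) (w : ℕ → ℝ) (n : ℕ) :
      ∑ k ∈ range (n + 1), c n (n - k) * w k = ∑ k ∈ range (n + 1), c n k * w (n - k) := by
    rw [← sum_range_reflect]
    refine sum_congr rfl fun k hk => ?_
    rw [Nat.add_sub_cancel, Nat.sub_sub_self (Nat.lt_succ_iff.1 (mem_range.1 hk))]
  have hxv (v : ℝ) (hv : 0 ≤ v) :
      IsStieltjesMoment fun n => ∑ k ∈ range (n + 1), A n k * v ^ (n - k) * x k :=
    isStieltjesMoment_sum_mul hx (B := fun n k => A n k * v ^ (n - k)) fun u hu => by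
      simpa only [mul_right_comm] using hA u v hu hv
  have hxy := isStieltjesMoment_sum_mul hy (B := fun n k => A n (n - k) * x (n - k)) fun v hv => by
    simp only [hreflect fun n k => A n k * x k]
    simpa only [mul_right_comm] using hxv v hv
  simp only [hreflect fun n k => A n k * x k] at hxy
  exact hxy

end Convolution

end StieltjesMomentProblem

section Jacobi

open Finset Matrix

section UpdateColumns

variable {ι κ R : Type*} [Fintype ι] [DecidableEq ι] [CommRing R]

/-- The identity matrix with the columns in the range of `I` replaced by the columns of `B`. The
minors of a matrix appear as determinants of square matrices of this form. -/
noncomputable def oneUpdateCols (I : κ ↪ ι) (B : Matrix ι κ R) : Matrix ι ι R :=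
  of fun i => Function.extend I (B i) ((1 : Matrix ι ι R) i)

theorem mul_oneUpdateCols_apply_mem (M : Matrix ι ι R) (I : κ ↪ ι) (B : Matrix ι κ R)
    (i : ι) (l : κ) : (M * oneUpdateCols I B) i (I l) = (M * B) i l := by
  simp only [mul_apply, oneUpdateCols, of_apply, I.injective.extend_apply]

theorem mul_oneUpdateCols_apply_notMem (M : Matrix ι ι R) (I : κ ↪ ι) (B : Matrix ι κ R)
    (i : ι) {j : ι} (hj : j ∉ Set.range I) : (M * oneUpdateCols I B) i j = M i j := by
  rw [← congrFun₂ (Matrix.mul_one M) i j]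
  simp only [mul_apply, oneUpdateCols, of_apply, Function.extend_apply' _ _ _ hj]

theorem det_oneUpdateCols [Fintype κ] [DecidableEq κ] (I : κ ↪ ι) (B : Matrix ι κ R) :
    (oneUpdateCols I B).det = (B.submatrix I id).det := by
  classical
  have hmem (i l) : oneUpdateCols I B i (I l) = B i l := by
    simpa using mul_oneUpdateCols_apply_mem 1 I B i l
  have hnotMem (i) {j} (hj : j ∉ Set.range I) : oneUpdateCols I B i j = (1 : Matrix ι ι R) i j := by
    simpa using mul_oneUpdateCols_apply_notMem 1 I B i hj
  rw [twoBlockTriangular_det' _ (∃ l, I l = ·) fun i hi j hj => by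
    rw [hnotMem i hj]
    exact one_apply_ne fun hij => hj (hij ▸ hi)]
  have hrange : (toSquareBlockProp (oneUpdateCols I B) (∃ l, I l = ·)).det =
      (B.submatrix I id).det := by
    let e : κ ≃ {i // ∃ l, I l = i} := Equiv.ofInjective I I.injective
    rw [← det_submatrix_equiv_self e]
    congr 1
    ext i j
    exact hmem _ _
  have hcompl : toSquareBlockProp (oneUpdateCols I B) (¬∃ l, I l = ·) = 1 := by
    ext i j
    rw [toSquareBlockProp_def, of_apply, hnotMem _ j.2, one_apply, one_apply]
    simp only [Subtype.ext_iff]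
  rw [hrange, hcompl, det_one, mul_one]

end UpdateColumns

section Minors

variable {R : Type*} [CommRing R]

theorem exists_orderEmbedding_succAbove_last {m n : ℕ} (I : Fin (m + 1) ↪o Fin (n + 1)) :
    ∃ I' : Fin m ↪o Fin n, ∀ l, (I (Fin.last m)).succAbove (I' l) = I l.castSucc ∧
      (I' l : ℕ) = I l.castSucc := by
  have hlt (l : Fin m) : I l.castSucc < I (Fin.last m) := I.strictMono (Fin.castSucc_lt_last l)
  refine ⟨OrderEmbedding.ofStrictMono
    (fun l => ⟨I l.castSucc, (Fin.lt_def.1 (hlt l)).trans_le (Fin.le_last (I (Fin.last m)))⟩)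
    fun a b hab => I.strictMono (Fin.castSucc_lt_castSucc_iff.2 hab),
    fun l => ⟨Fin.succAbove_of_castSucc_lt _ _ (hlt l), rfl⟩⟩

theorem exists_det_eq_minor_of_submatrix_eq_one {m : ℕ} : ∀ {n : ℕ}
    (A : Matrix (Fin n) (Fin n) R) (I J : Fin m ↪o Fin n),
    (∀ i l, A i (I l) = (1 : Matrix (Fin n) (Fin n) R) i (J l)) →
    ∃ (d : ℕ) (r c : Fin d ↪o Fin n), (∀ p, c p ∉ Set.range I) ∧
      A.det = (-1) ^ (∑ l, (I l : ℕ) + ∑ l, (J l : ℕ)) * (A.submatrix r c).det := by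
  induction m with
  | zero =>
    intro n A I J _
    exact ⟨n, RelEmbedding.refl _, RelEmbedding.refl _, by simp, by simp⟩
  | succ m ih =>
    rintro (_ | n) A I J hA
    · exact (I 0).elim0
    obtain ⟨I', hI'⟩ := exists_orderEmbedding_succAbove_last I
    obtain ⟨J', hJ'⟩ := exists_orderEmbedding_succAbove_last J
    set i₀ := I (Fin.last m) with hi₀
    set j₀ := J (Fin.last m) with hj₀
    obtain ⟨d, r, c, hc, hdet⟩ := ih (A.submatrix j₀.succAbove i₀.succAbove) I' J' fun i l => by
      rw [submatrix_apply, (hI' l).1, hA, ← (hJ' l).1]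
      simp only [one_apply, Fin.succAbove_right_inj]
    have hexpand : A.det =
        (-1) ^ ((j₀ : ℕ) + i₀) * (A.submatrix j₀.succAbove i₀.succAbove).det := by
      rw [det_succ_column A i₀, sum_eq_single_of_mem j₀ (mem_univ _) fun i _ hi => ?_]
      · rw [hA, ← hj₀, one_apply_eq, mul_one]
      · rw [hA, ← hj₀, one_apply_ne hi, mul_zero, zero_mul]
    refine ⟨d, r.trans (Fin.succAboveOrderEmb j₀), c.trans (Fin.succAboveOrderEmb i₀), ?_, ?_⟩
    · rintro p ⟨l, hl⟩
      induction l using Fin.lastCases with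
      | last => exact Fin.succAbove_ne i₀ (c p) hl.symm
      | cast l =>
        rw [← (hI' l).1] at hl
        exact hc p ⟨l, Fin.succAbove_right_injective hl⟩
    · rw [hexpand, hdet, Fin.sum_univ_castSucc, Fin.sum_univ_castSucc, ← mul_assoc, ← pow_add]
      simp only [(hI' _).2, (hJ' _).2, ← hi₀, ← hj₀]
      congr 2
      ring

/-- Jacobi's complementary minor formula. -/
theorem exists_det_mul_minor_eq_of_mul_eq_one {n m : ℕ} {M N : Matrix (Fin n) (Fin n) R}
    (h : M * N = 1) (I J : Fin m ↪o Fin n) : ∃ (d : ℕ) (r c : Fin d ↪o Fin n),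
      M.det * (N.submatrix I J).det =
        (-1) ^ (∑ l, (I l : ℕ) + ∑ l, (J l : ℕ)) * (M.submatrix r c).det := by
  set A := M * oneUpdateCols I.toEmbedding (N.submatrix id J) with hA
  obtain ⟨d, r, c, hc, hdet⟩ := exists_det_eq_minor_of_submatrix_eq_one A I J fun i l => by
    rw [← h]
    exact mul_oneUpdateCols_apply_mem M I.toEmbedding _ i l
  have hminor : A.submatrix r c = M.submatrix r c :=
    ext fun i j => mul_oneUpdateCols_apply_notMem M I.toEmbedding _ (r i) (hc j)
  refine ⟨d, r, c, ?_⟩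
  rw [← hminor, ← hdet, hA, det_mul, det_oneUpdateCols]
  rfl

theorem det_submatrix_neg_one_pow_mul (N : Matrix ℕ ℕ R) {m : ℕ} (r c : Fin m → ℕ) :
    ((of fun n k => (-1 : R) ^ (n + k) * N n k).submatrix r c).det =
      (-1) ^ (∑ l, r l + ∑ l, c l) * (N.submatrix r c).det := by
  rw [pow_add, ← prod_pow_eq_pow_sum, ← prod_pow_eq_pow_sum, mul_assoc, ← det_mul_row,
    ← det_mul_column]
  congr 1
  ext i j
  simp only [submatrix_apply, of_apply, pow_add, mul_assoc]

end Minors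

theorem isTP_neg_one_pow_mul_of_mul_eq_one {M N : Matrix ℕ ℕ ℝ} (hM : IsTP M)
    (h : ∀ n, M.submatrix (Fin.val (n := n)) (Fin.val (n := n)) *
      N.submatrix (Fin.val (n := n)) (Fin.val (n := n)) = 1) :
    IsTP (of fun n k => (-1 : ℝ) ^ (n + k) * N n k) := by
  intro m r c
  obtain ⟨n, hn⟩ := (univ.image r ∪ univ.image c).exists_nat_subset_range
  have hr (i) : r i < n := by simpa using hn (mem_union_left _ (mem_image_of_mem r (mem_univ i)))
  have hc (i) : c i < n := by simpa using hn (mem_union_right _ (mem_image_of_mem c (mem_univ i)))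
  let I : Fin m ↪o Fin n := OrderEmbedding.ofStrictMono (fun i => ⟨r i, hr i⟩) r.strictMono
  let J : Fin m ↪o Fin n := OrderEmbedding.ofStrictMono (fun i => ⟨c i, hc i⟩) c.strictMono
  set M' := M.submatrix (Fin.val (n := n)) (Fin.val (n := n))
  obtain ⟨d, r', c', hdet⟩ : ∃ (d : ℕ) (r' c' : Fin d ↪o Fin n), M'.det * (N.submatrix r c).det =
      (-1) ^ (∑ l, r l + ∑ l, c l) * (M'.submatrix r' c').det :=
    exists_det_mul_minor_eq_of_mul_eq_one (h n) I J
  have hMdet : 0 < M'.det :=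
    (hM n (Fin.valOrderEmb n) (Fin.valOrderEmb n)).lt_of_ne'
      (isUnit_det_of_right_inverse (h n)).ne_zero
  refine nonneg_of_mul_nonneg_right ?_ hMdet
  calc (0 : ℝ) ≤ (M'.submatrix r' c').det :=
      hM d (r'.trans (Fin.valOrderEmb n)) (c'.trans (Fin.valOrderEmb n))
    _ = (-1) ^ (∑ l, r l + ∑ l, c l) * (M'.det * (N.submatrix r c).det) := by
      rw [hdet, ← mul_assoc, ← mul_pow, neg_one_mul, neg_neg, one_pow, one_mul]
    _ = M'.det * matMinor (of fun n k => (-1 : ℝ) ^ (n + k) * N n k) r c := by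
      rw [matMinor, det_submatrix_neg_one_pow_mul]
      ring

end Jacobi

section CompositionalInverse

open Finset Matrix PowerSeries

theorem expRiordan_submatrix_mul {R : Type*} [CommRing R] [Algebra ℚ R] {F : PowerSeries R}
    (hF : constantCoeff F = 0) (G H L : PowerSeries R) (n : ℕ) :
    (expRiordan H F).submatrix (Fin.val (n := n)) (Fin.val (n := n)) *
        (expRiordan L G).submatrix (Fin.val (n := n)) (Fin.val (n := n)) =
      (expRiordan (H * L.subst F) (G.subst F)).submatrix Fin.val Fin.val := by
  ext i k
  rw [mul_apply, submatrix_apply, expRiordan_mul_apply hF, ← sum_range_eq_of_le i.2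
    fun j hj => by rw [expRiordan_eq_zero hF H hj, zero_mul], sum_range]
  rfl

variable {K : Type*} [Field K]

theorem mul_subst_inv_subst {F G H : PowerSeries K} (hF : constantCoeff F = 0)
    (hG : constantCoeff G = 0) (hGF : G.subst F = (X : PowerSeries K))
    (hH : constantCoeff H ≠ 0) : H * ((H.subst G)⁻¹ : PowerSeries K).subst F = 1 := by
  have hsF : HasSubst F := HasSubst.of_constantCoeff_zero' hF
  have hsG : HasSubst G := HasSubst.of_constantCoeff_zero' hG
  have hunit : constantCoeff (H.subst G : PowerSeries K) ≠ 0 := by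
    rwa [constantCoeff_subst_powerSeries hG]
  have hinv := congrArg (PowerSeries.subst F) (PowerSeries.mul_inv_cancel _ hunit)
  rwa [subst_mul hsF, subst_comp_subst_apply hsG hsF, hGF, X_subst, subst_one_powerSeries hF]
    at hinv

theorem isShefferSystem_substInv {F : PowerSeries K} (hF : constantCoeff F = 0)
    (hF1 : coeff 1 F ≠ 0) :
    IsShefferSystem 1 0 0 ((1 + X) * derivative K (F.substInvOfIsUnit hF1.isUnit))⁻¹ F 1 where
  constantCoeff_left := hF
  constantCoeff_right := map_one _
  derivative_left := by
    set G := F.substInvOfIsUnit hF1.isUnit with hG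
    have hs : HasSubst F := HasSubst.of_constantCoeff_zero' hF
    have hchain : (derivative K G).subst F * derivative K F = 1 := by
      rw [← derivative_subst hs, hG, subst_substInvOfIsUnit_left F hF hF1.isUnit, derivative_X]
    have hunit : constantCoeff ((1 + X) * derivative K G) ≠ 0 := by
      rw [map_mul, map_add, ← coeff_zero_eq_constantCoeff_apply (derivative K G),
        coeff_derivative, hG, zero_add, coeff_one_substInvOfIsUnit]
      simpa using hF1
    have hinv : (1 + F) * (derivative K G).subst F *
        (((1 + X) * derivative K G)⁻¹).subst F = 1 := by
      have := congrArg (PowerSeries.subst F) (PowerSeries.mul_inv_cancel _ hunit)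
      rwa [subst_mul hs, subst_mul hs, subst_add hs, subst_X hs, subst_one_powerSeries hF] at this
    rw [map_one]
    linear_combination (1 + F) * (((1 + X) * derivative K G)⁻¹).subst F * hchain -
      derivative K F * hinv
  derivative_right := by simp

end CompositionalInverse

section TotalPositivity

open Matrix PowerSeries

variable {φ f : PowerSeries ℝ}

theorem IsShefferSystem.liftSeries (h : IsShefferSystem 1 0 0 φ f 1) (σ : Type*) :
    IsShefferSystem 1 0 0 (liftSeries σ φ) (liftSeries σ f) 1 := by
  have h' := h.map (MvPolynomial.C (σ := σ))
  rwa [map_one, map_one, map_zero] at h'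

theorem IsPF.minorsIn_toeplitz_liftSeries (hφ : IsPF φ) (σ : Type*) :
    MinorsIn (coeffNonnegSubsemiring σ) (toeplitzMatrix fun n => coeff n (liftSeries σ φ)) := by
  convert (isTP_iff_minorsIn.1 hφ).map (MvPolynomial.C (σ := σ))
    (fun _ => C_mem_coeffNonnegSubsemiring) using 1
  ext1 i j
  rw [map_apply, toeplitzMatrix, toeplitzMatrix, of_apply, of_apply, apply_ite MvPolynomial.C,
    map_zero]
  rfl

theorem algebraMap_rat_mem_coeffNonnegSubsemiring (σ : Type*) {x : ℚ} (hx : 0 ≤ x) :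
    algebraMap ℚ (MvPolynomial σ ℝ) x ∈ coeffNonnegSubsemiring σ := by
  rw [IsScalarTower.algebraMap_apply ℚ ℝ (MvPolynomial σ ℝ)]
  exact C_mem_coeffNonnegSubsemiring (by simpa using hx)

theorem isCoeffTP_shefferTriangle {σ : Type*} (h : IsShefferSystem 1 0 0 φ f 1) (hφ : IsPF φ)
    {γ l : MvPolynomial σ ℝ} (hγ : γ ∈ coeffNonnegSubsemiring σ)
    (hl : l ∈ coeffNonnegSubsemiring σ) :
    IsCoeffTP (shefferTriangle (liftSeries σ f) (shefferG γ l (liftSeries σ f))) := by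
  have hF := (h.liftSeries σ).shefferG γ l
  rw [shefferTriangle_eq_expRiordan hF.constantCoeff_left]
  exact hF.minorsIn_expRiordan (fun _ => algebraMap_rat_mem_coeffNonnegSubsemiring σ) (one_mem _)
    hl hγ (hφ.minorsIn_toeplitz_liftSeries σ)

theorem isCoeffSM_shefferForm {σ : Type*} (h : IsShefferSystem 1 0 0 φ f 1) (hφ : IsPF φ)
    {γ l u v : MvPolynomial σ ℝ} (hγ : γ ∈ coeffNonnegSubsemiring σ)
    (hl : l ∈ coeffNonnegSubsemiring σ) (hu : u ∈ coeffNonnegSubsemiring σ)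
    (hv : v ∈ coeffNonnegSubsemiring σ) :
    IsCoeffSM (shefferForm (liftSeries σ f) (shefferG γ l (liftSeries σ f)) u v) :=
  ((h.liftSeries σ).shefferG γ l).minorsIn_hankel_shefferForm
    (fun _ => algebraMap_rat_mem_coeffNonnegSubsemiring σ) (one_mem _) hl hγ
    (hφ.minorsIn_toeplitz_liftSeries σ) hu hv

theorem isCoeffSM_shefferSeq {σ : Type*} (h : IsShefferSystem 1 0 0 φ f 1) (hφ : IsPF φ)
    {γ l q : MvPolynomial σ ℝ} (hγ : γ ∈ coeffNonnegSubsemiring σ)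
    (hl : l ∈ coeffNonnegSubsemiring σ) (hq : q ∈ coeffNonnegSubsemiring σ) :
    IsCoeffSM (shefferSeq (liftSeries σ f) (shefferG γ l (liftSeries σ f)) q) := by
  rw [shefferSeq_eq_shefferForm (h.liftSeries σ).constantCoeff_left]
  exact isCoeffSM_shefferForm h hφ hγ hl hq (one_mem _)

theorem isCoeffSM_shefferRecipSeq {σ : Type*} (h : IsShefferSystem 1 0 0 φ f 1) (hφ : IsPF φ)
    {γ l q : MvPolynomial σ ℝ} (hγ : γ ∈ coeffNonnegSubsemiring σ)
    (hl : l ∈ coeffNonnegSubsemiring σ) (hq : q ∈ coeffNonnegSubsemiring σ) :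
    IsCoeffSM (shefferRecipSeq (liftSeries σ f) (shefferG γ l (liftSeries σ f)) q) := by
  rw [shefferRecipSeq_eq_shefferForm (h.liftSeries σ).constantCoeff_left]
  exact isCoeffSM_shefferForm h hφ hγ hl (one_mem _) hq

theorem isCoeffSM_shefferSeq_onePlusPow {σ : Type*} (h : IsShefferSystem 1 0 0 φ f 1)
    (hφ : IsPF φ) {γ q : MvPolynomial σ ℝ} (hγ : γ ∈ coeffNonnegSubsemiring σ)
    (hq : q ∈ coeffNonnegSubsemiring σ) :
    IsCoeffSM (shefferSeq (liftSeries σ f) (onePlusPow γ (liftSeries σ f)) q) := by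
  rw [← mul_one (onePlusPow γ _), ← expSeries_zero (h.liftSeries σ).constantCoeff_left]
  exact isCoeffSM_shefferSeq h hφ hγ (zero_mem _) hq

theorem isTP_shefferTriangle (h : IsShefferSystem 1 0 0 φ f 1) (hφ : IsPF φ) {γ l : ℝ}
    (hγ : 0 ≤ γ) (hl : 0 ≤ l) : IsTP (shefferTriangle f (shefferG γ l f)) := by
  have hF := h.shefferG γ l
  rw [shefferTriangle_eq_expRiordan hF.constantCoeff_left]
  exact hF.minorsIn_expRiordan (S := Subsemiring.nonneg ℝ) (fun x hx => by simpa using hx)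
    (one_mem _) hl hγ hφ

theorem isTP_hankel_shefferForm (h : IsShefferSystem 1 0 0 φ f 1) (hφ : IsPF φ) {γ l u v : ℝ}
    (hγ : 0 ≤ γ) (hl : 0 ≤ l) (hu : 0 ≤ u) (hv : 0 ≤ v) :
    IsTP (hankelMatrix (shefferForm f (shefferG γ l f) u v)) :=
  (h.shefferG γ l).minorsIn_hankel_shefferForm (S := Subsemiring.nonneg ℝ)
    (fun x hx => by simpa using hx) (one_mem _) hl hγ hφ hu hv

theorem isStieltjesMoment_triConvolution_shefferTriangle (h : IsShefferSystem 1 0 0 φ f 1)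
    (hφ : IsPF φ) {γ l : ℝ} (hγ : 0 ≤ γ) (hl : 0 ≤ l) {x y : ℕ → ℝ} (hx : IsStieltjesMoment x)
    (hy : IsStieltjesMoment y) :
    IsStieltjesMoment (triConvolution (shefferTriangle f (shefferG γ l f)) x y) := by
  rw [shefferTriangle_eq_expRiordan h.constantCoeff_left]
  exact isStieltjesMoment_triConvolution (fun u v hu hv =>
    isStieltjesMoment_of_isTP_hankel (isTP_hankel_shefferForm h hφ hγ hl hu hv)) hx hy

theorem isTP_neg_one_pow_mul_shefferTriangle_substInv (h : IsShefferSystem 1 0 0 φ f 1)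
    (hφ : IsPF φ) (hf1 : coeff 1 f ≠ 0) {γ l : ℝ} (hγ : 0 ≤ γ) (hl : 0 ≤ l) :
    IsTP (of fun n k => (-1 : ℝ) ^ (n + k) *
      shefferTriangle (f.substInvOfIsUnit hf1.isUnit)
        (composeSeries (shefferG γ l f) (f.substInvOfIsUnit hf1.isUnit))⁻¹ n k) := by
  have hf0 := h.constantCoeff_left
  have hinv0 := constantCoeff_substInvOfIsUnit f hf1.isUnit
  have hinv := subst_substInvOfIsUnit_left f hf0 hf1.isUnit
  have hG : constantCoeff (shefferG γ l f) ≠ 0 := by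
    rw [(h.shefferG γ l).constantCoeff_right]
    exact one_ne_zero
  refine isTP_neg_one_pow_mul_of_mul_eq_one (isTP_shefferTriangle h hφ hγ hl) fun n => ?_
  rw [shefferTriangle_eq_expRiordan hf0, shefferTriangle_eq_expRiordan hinv0,
    expRiordan_submatrix_mul hf0, hinv, composeSeries, mul_subst_inv_subst hf0 hinv0 hinv hG,
    expRiordan_one_X, submatrix_one _ Fin.val_injective]

end TotalPositivity

theorem mainTheorem7 (f : PowerSeries ℝ) (hf0 : PowerSeries.constantCoeff f = 0)
    (hf1 : PowerSeries.coeff 1 f ≠ 0)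
    (hPF : IsPF (((1 + PowerSeries.X) *
      PowerSeries.derivative ℝ (f.substInvOfIsUnit hf1.isUnit))⁻¹)) :
    -- indeterminates `γ, l, q`; `g = (1 + f) ^ γ * exp (l f)`
    (let γ : MvPolynomial (Fin 3) ℝ := MvPolynomial.X 0
     let l : MvPolynomial (Fin 3) ℝ := MvPolynomial.X 1
     let q : MvPolynomial (Fin 3) ℝ := MvPolynomial.X 2
     let F := liftSeries (Fin 3) f
     IsCoeffSM (shefferSeq F (shefferG γ l F) q) ∧
     IsKCoeffLogConvex 3 (shefferSeq F (shefferG γ l F) q) ∧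
     IsCoeffSM (shefferRecipSeq F (shefferG γ l F) q) ∧
     IsKCoeffLogConvex 3 (shefferRecipSeq F (shefferG γ l F) q)) ∧
    -- indeterminates `γ, q`
    (let γ : MvPolynomial (Fin 2) ℝ := MvPolynomial.X 0
     let q : MvPolynomial (Fin 2) ℝ := MvPolynomial.X 1
     let F := liftSeries (Fin 2) f
     IsCoeffSM (shefferSeq F (onePlusPow γ F) q) ∧
     IsKCoeffLogConvex 3 (shefferSeq F (onePlusPow γ F) q)) ∧
    -- `f = ∑ f_n t ^ n / n!`
    (IsStieltjesMoment (fun n => ((n + 1).factorial : ℝ) * PowerSeries.coeff (n + 1) f) ∧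
     IsKLogConvex 3 (fun n => ((n + 1).factorial : ℝ) * PowerSeries.coeff (n + 1) f)) ∧
    -- indeterminates `γ, l`
    (let γ : MvPolynomial (Fin 2) ℝ := MvPolynomial.X 0
     let l : MvPolynomial (Fin 2) ℝ := MvPolynomial.X 1
     let F := liftSeries (Fin 2) f
     IsCoeffTP (shefferTriangle F (shefferG γ l F))) ∧
    -- nonnegative real `γ, l`
    (∀ γ l : ℝ, 0 ≤ γ → 0 ≤ l →
      IsTP (Matrix.of fun n k => (-1 : ℝ) ^ (n + k) *
        shefferTriangle (f.substInvOfIsUnit hf1.isUnit)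
          (composeSeries (shefferG γ l f) (f.substInvOfIsUnit hf1.isUnit))⁻¹ n k)) ∧
    (∀ γ l : ℝ, 0 ≤ γ → 0 ≤ l → ∀ x y : ℕ → ℝ, IsStieltjesMoment x → IsStieltjesMoment y →
      IsStieltjesMoment (triConvolution (shefferTriangle f (shefferG γ l f)) x y)) := by
  have h := isShefferSystem_substInv hf0 hf1
  have hX {σ : Type} (i : σ) := X_mem_coeffNonnegSubsemiring i
  have hseq := isCoeffSM_shefferSeq h hPF (hX (0 : Fin 3)) (hX 1) (hX 2)
  have hrecip := isCoeffSM_shefferRecipSeq h hPF (hX (0 : Fin 3)) (hX 1) (hX 2)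
  have hpow := isCoeffSM_shefferSeq_onePlusPow h hPF (hX (0 : Fin 2)) (hX 1)
  have hderiv := isTP_hankel_derivative h hPF
  exact ⟨⟨hseq, isKCoeffLogConvex_three_of_isCoeffSM hseq, hrecip,
    isKCoeffLogConvex_three_of_isCoeffSM hrecip⟩,
    ⟨hpow, isKCoeffLogConvex_three_of_isCoeffSM hpow⟩,
    ⟨isStieltjesMoment_of_isTP_hankel hderiv, isKLogConvex_three_of_isTP_hankel hderiv⟩,
    isCoeffTP_shefferTriangle h hPF (hX 0) (hX 1),
    fun _ _ => isTP_neg_one_pow_mul_shefferTriangle_substInv h hPF hf1,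
    fun _ _ hγ hl _ _ => isStieltjesMoment_triConvolution_shefferTriangle h hPF hγ hl⟩
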